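/- Let $n\ge 0$ and $t\ge 0$. **Plane trees.** A plane tree is a finite unlabeled rooted tree in which the successors of every node are linearly ordered from left to right. Its degree sequence $(d_1,d_2,\ldots)$ lists the numbers of successors of its nodes in depth-first order (each node before its descendants, subtrees from left to right). **Polytopes.** The $t$-Cayley polytope is $$C_n(t)=\{(x_1,\ldots,x_n)\in\mathbb R^n : 1\le x_1\le 1+t,\ 1\le x_i\le (1+t)x_{i-1}\text{ for } 2\le i\le n\}.$$ Let $T$ be a plane tree on $n+1$ nodes. Attach a coordinate $x_i/(1+t)^j$ to each node of $T$ as follows. The root gets $x_0/(1+t)^0$. Start with the root active. Whenever a node with coordinate $x_i/(1+t)^j$ and successors $v_1,\ldots,v_k$ (from left to right) is active, visit $v_k,\ldots,v_1$ in this order and give them the coordinates $x_p/(1+t)^j,\ x_{p+1}/(1+t)^{j+1},\ldots,x_{p+k-1}/(1+t)^{j+k-1}$, where $p-1$ is the largest index used so far; then the last visited node that has not been active becomes active. The set $D_T(t)\subset\mathbb R^n$ is defined by the inequalities $$1\le \frac{x_{i+k-1}}{(1+t)^{j+k-1}}\le\cdots\le\frac{x_{i+1}}{(1+t)^{j+1}}\le\frac{x_i}{(1+t)^j}\le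 1+t,$$ one chain for each node of $T$ with $k\ge 1$ successors, where $x_i/(1+t)^j,\ldots,x_{i+k-1}/(1+t)^{j+k-1}$ are the coordinates of its successors. **Graphs.** Let $\mathcal G_{n+1}$ be the set of simple graphs on the nodes $1,\ldots,n+1$, and $\mathcal C_{n+1}$ the set of connected ones. The neighbors-first search of a connected labeled graph starts with the node of maximal label active; it visits the unvisited neighbors of the active node in decreasing order of labels, as successors of the active node, and then the last visited node that has not been active becomes active, until every visited node has been active. For a graph $G$, perform this search in each component, the components being ordered by decreasing maximal label. This gives a rooted labeled forest $\Phi(G)$; order the successors of each node by increasing label from left to right and erase the labels to get a plane forest $\Psi(G)$. ($\Psi(G)=T$ for a plane tree $T$ means that $T$ is the only component of $\Psi(G)$.) **Theorem.** For every plane tree $T$ on $n+1$ nodes, the set $D_T(t)$ is a bounded polytope, and $$n!\,\mathrm{vol}\,D_T(t)=\sum_{G\in\mathcal G_{n+1},\ \Psi(G)=T}t^{|E(G)|}=t^n(1+t)^{\binom{n+1}2-\sum_{i=1}^{n+1} i\,d_i}\binom{n}{d_1,d_2,\ldots,d_{n+1}},$$ where $(d_1,\ldots,d_{n+1})$ is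 the degree sequence of $T$. Furthermore, the polytopes $D_T(t)$, with $T$ running over the plane trees on $n+1$ nodes, form a polytopal subdivision of $C_n(t)$: they are finitely many polytopes of the same dimension as $C_n(t)$, their union is $C_n(t)$, distinct ones have disjoint relative interiors, and any two meet in a common (possibly empty) face. For $t>0$, different trees $T$ give different polytopes $D_T(t)$. In particular, $$n!\,\mathrm{vol}\,C_n(t)=\sum_{G\in\mathcal C_{n+1}}t^{|E(G)|}.$$ -/

import Mathlib

namespace CayleyPolytope

/-! ### Plane trees -/

/-- An unlabeled plane tree: a root together with the list, from left to right, of the subtrees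
at its successors. -/
inductive PlaneTree : Type
  | node : List PlaneTree → PlaneTree

namespace PlaneTree

mutual
/-- The number of nodes of a plane tree. -/
def numNodes : PlaneTree → ℕ
  | .node ts => 1 + numNodesList ts
/-- The total number of nodes of a list of plane trees. -/
def numNodesList : List PlaneTree → ℕ
  | [] => 0
  | T :: ts => numNodes T + numNodesList ts
end

mutual
/-- The degree sequence: the numbers of successors of the nodes in depth-first order (a node comes
before its descendants, and the subtrees at a node are traversed from left to right). -/
def degSeq : PlaneTree → List ℕ
  | .node ts => ts.length :: degSeqList ts
/-- The concatenation of the degree sequences of a list of plane trees. -/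
def degSeqList : List PlaneTree → List ℕ
  | [] => []
  | T :: ts => degSeq T ++ degSeqList ts
end

/-- `T.deg i` is the `i`-th entry `dᵢ` of the degree sequence, `i = 1, 2, …, T.numNodes`. -/
def deg (T : PlaneTree) (i : ℕ) : ℕ := T.degSeq.getD (i - 1) 0

mutual
/-- The coordinates of the nodes. Suppose that a node with coordinate `x_ / (1 + t) ^ j` becomes
active in the neighbors-first search when the positions `0, …, p - 1` have been used. Its
successors `v₁, …, v_k` (from left to right) are then visited from right to left, so they
get the positions `p, …, p + k - 1` and the coordinates
`x_p / (1 + t) ^ j` for `v_k`, …, `x_(p+k-1) / (1 + t) ^ (j + k - 1)` for `v₁`; after that the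
search goes through the whole subtree at `v₁`, then through the one at `v₂`, and so on.
The result lists, for all nodes of the tree, the triple `(p, j, k)`. -/
def siblingGroups : PlaneTree → ℕ → ℕ → List (ℕ × ℕ × ℕ)
  | .node ts, p, j => (p, j, ts.length) :: siblingGroupsList ts (p + ts.length) j
/-- The same for the subtrees at the successors `v_l, …, v_k` of a node, when `p` positions
have been used: the exponent at `v_l` is `j + (k - l)`, and the `numNodes - 1` proper
descendants of `v_l` use up that many positions before `v_(l+1)` becomes active. -/
def siblingGroupsList : List PlaneTree → ℕ → ℕ → List (ℕ × ℕ × ℕ)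
  | [], _, _ => []
  | T :: ts, p, j =>
      siblingGroups T p (j + ts.length) ++ siblingGroupsList ts (p + (numNodes T - 1)) j
end

end PlaneTree

/-! ### The polytopes -/

/-- The coordinate `xᵢ`, `i = 1, …, n`, of a point `(x₁, …, xₙ)` of `ℝⁿ`
(and `0` for all other `i`, which do not occur below). -/
def coord {n : ℕ} (x : Fin n → ℝ) (i : ℕ) : ℝ :=
  if h : 1 ≤ i ∧ i ≤ n then x ⟨i - 1, by omega⟩ else 0

/-- The `t`-Cayley polytope `Cₙ(t)`. -/
def cayley (n : ℕ) (t : ℝ) : Set (Fin n → ℝ) :=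
  {x | (1 ≤ n → 1 ≤ coord x 1 ∧ coord x 1 ≤ 1 + t) ∧
    ∀ i, 2 ≤ i → i ≤ n → 1 ≤ coord x i ∧ coord x i ≤ (1 + t) * coord x (i - 1)}

/-- The polytope `D_T(t)` in `ℝⁿ`, for a plane tree `T` on `n + 1` nodes: for every node whose
successors have coordinates `x_i/(1+t)^j, …, x_(i+k-1)/(1+t)^(j+k-1)`, `k ≥ 1`, the inequalities
`1 ≤ x_(i+k-1)/(1+t)^(j+k-1) ≤ ⋯ ≤ x_(i+1)/(1+t)^(j+1) ≤ x_i/(1+t)^j ≤ 1 + t`.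
The root has position `0` and exponent `0`. -/
def treePolytope (n : ℕ) (T : PlaneTree) (t : ℝ) : Set (Fin n → ℝ) :=
  {x | ∀ i j k : ℕ, (i, j, k) ∈ T.siblingGroups 1 0 → 1 ≤ k →
    1 ≤ coord x (i + k - 1) / (1 + t) ^ (j + k - 1) ∧
    (∀ m, m + 1 < k →
      coord x (i + m + 1) / (1 + t) ^ (j + m + 1) ≤ coord x (i + m) / (1 + t) ^ (j + m)) ∧
    coord x i / (1 + t) ^ j ≤ 1 + t}

/-! ### Neighbors-first search -/

/-- A rooted labeled tree, with the subtrees at each node kept in a list. -/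
inductive LabeledTree (V : Type) : Type
  | node : V → List (LabeledTree V) → LabeledTree V

mutual
/-- Erase the labels. -/
def LabeledTree.erase {V : Type} : LabeledTree V → PlaneTree
  | .node _ ts => .node (LabeledTree.eraseList ts)
/-- Erase the labels in a list of trees. -/
def LabeledTree.eraseList {V : Type} : List (LabeledTree V) → List PlaneTree
  | [] => []
  | T :: ts => LabeledTree.erase T :: LabeledTree.eraseList ts
end

/-- Neighbors-first search on `G`. Here `U` is the set of the nodes that have not been visited, and
the list contains the visited nodes that have not been active, the last visited one first.
That one, `v`, becomes active, and its neighbors in `U` are visited in decreasing order, so that the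
smallest of them is the last visited node afterwards. The value is the list of the search trees
that grow from the nodes in the given list. The first ones of the trees found by the rest of
the search grow from the successors of `v`; these trees, in increasing order of their roots,
are the subtrees at `v`. -/
def nfs {V : Type} [LinearOrder V] (G : SimpleGraph V) [DecidableRel G.Adj] :
    Finset V → List V → List (LabeledTree V)
  | _, [] => []
  | U, v :: S =>
      let N := U.filter (fun w => G.Adj v w)
      let L := nfs G (U \ N) (N.sort (· ≤ ·) ++ S)
      .node v (L.take N.card) :: L.drop N.card
  termination_by U S => U.card + S.length
  decreasing_by
    have h1 := Finset.card_sdiff_add_card_eq_card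
      (Finset.filter_subset (fun w => G.Adj v w) U)
    simp only [List.length_append, Finset.length_sort, List.length_cons]
    omega

open Classical in
/-- The search forest `Φ(G)`: the components are ordered so that their maximal labels decrease, and
in each of them the search starts at the node with the maximal label. -/
noncomputable def searchForest {V : Type} [Fintype V] [LinearOrder V] (G : SimpleGraph V) :
    List (LabeledTree V) :=
  ((Finset.univ.filter (fun r => ∀ w, G.Reachable r w → w ≤ r)).sort (· ≥ ·)).flatMap
    (fun r => nfs G (Finset.univ.erase r) [r])

/-- The plane forest `Ψ(G)`, the list of its components from left to right: the search forest
without its labels. It is the plane tree `T` when it has `T` as its only component. -/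
noncomputable def planeForest {V : Type} [Fintype V] [LinearOrder V] (G : SimpleGraph V) :
    List PlaneTree :=
  LabeledTree.eraseList (searchForest G)

/-! ### Polytopes and subdivisions -/

/-- A (non-empty, bounded) convex polytope: the convex hull of a non-empty finite set. -/
def IsPolytope {E : Type} [AddCommGroup E] [Module ℝ E] (P : Set E) : Prop :=
  ∃ S : Set E, S.Finite ∧ S.Nonempty ∧ P = convexHull ℝ S

/-- The finitely many polytopes in `𝒟` are the maximal cells of a polytopal subdivision of `P`:
they have the dimension of `P`, their union is `P`, distinct ones have disjoint relative
interiors, and any two of them meet in a common (possibly empty) face. -/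
structure IsPolytopalSubdivision {E : Type} [NormedAddCommGroup E] [NormedSpace ℝ E]
    (P : Set E) (𝒟 : Set (Set E)) : Prop where
  finite : 𝒟.Finite
  isPolytope : ∀ D ∈ 𝒟, IsPolytope D
  affineSpan_eq : ∀ D ∈ 𝒟, affineSpan ℝ D = affineSpan ℝ P
  sUnion_eq : ⋃₀ 𝒟 = P
  disjoint_interior : ∀ D ∈ 𝒟, ∀ D' ∈ 𝒟, D ≠ D' →
    Disjoint (intrinsicInterior ℝ D) (intrinsicInterior ℝ D')
  inter_isFace : ∀ D ∈ 𝒟, ∀ D' ∈ 𝒟, IsExposed ℝ D (D ∩ D') ∧ IsExposed ℝ D' (D ∩ D')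

end CayleyPolytope

-- Plane forests and their degree sequences

namespace CayleyPolytope

namespace PlaneTree

-- Put `q = 1/(1+t)` and rescale by `y_i = q^i x_i`. The Cayley polytope becomes the set of
-- decreasing vectors with `q^i ≤ y_i ≤ 1` (`mem_cayley_iff`). Cutting at the powers of `q`
-- decomposes it into cells, where `y_i` lies in `[q^(a_i+1), q^(a_i)]` for a weakly increasing
-- vector `a` with `0 ≤ a_i < i` (`cayley_eq_biUnion`). Such vectors correspond to plane trees: the
-- number of `i` with `a_i = l` is the degree of the node in depth-first position `l`, counted from
-- `0`, and the bound on `a` is exactly the ballot condition for degree sequences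
-- (`PlaneTree.block_mem_park`, `PlaneTree.exists_block_eq`). The exponent of a coordinate in the
-- tree polytope is such that rescaling turns the chain of each node into the conditions on one
-- block, so the tree polytopes are the cells (`treePolytope_eq`).
--
-- The geometry is then that of the cells. The permutations fixing `a` move a cell around so as to
-- tile a box, which gives the volume (`volume_cell`); two cells that meet do so in the face where a
-- functional with coefficients `0, ±1` is maximal (`exists_functional_cell`).
--
-- On the graph side, let a search have unvisited set `U` and waiting list `v :: S`. Activating `v`
-- reveals its edges to `U`, which must form a set of the prescribed size `d`, while its edges to
-- `S` do not affect the search. This gives a factor `t^d` times a binomial coefficient, and a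
-- factor `(1+t)^|S|`. The product over all steps is a multinomial coefficient times powers of `t`
-- and `1+t` (`sum_eraseList_nfs_eq`). Both exponents of `1+t`, from volumes and from graphs, equal
-- `C(n+1,2) - ∑ i d_i` (`PlaneTree.waitSum_add_weight`, `PlaneTree.sum_sub_block_add_weight`). The
-- last formula follows by summing over all trees, since a graph is connected exactly when its
-- search forest is a single tree.

theorem numNodesList_append (ts us : List PlaneTree) :
    numNodesList (ts ++ us) = numNodesList ts + numNodesList us := by
  induction ts with
  | nil => simp [numNodesList]
  | cons T ts ih => simp [numNodesList, ih, add_assoc]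

theorem degSeqList_append (ts us : List PlaneTree) :
    degSeqList (ts ++ us) = degSeqList ts ++ degSeqList us := by
  induction ts with
  | nil => simp [degSeqList]
  | cons T ts ih => simp [degSeqList, ih]

/-- Induction on plane forests, replacing the first root by its successors. -/
theorem forest_induction {P : List PlaneTree → Prop} (nil : P [])
    (cons : ∀ cs ts, P (cs ++ ts) → P (.node cs :: ts)) (ts : List PlaneTree) : P ts := by
  induction h : numNodesList ts using Nat.strong_induction_on generalizing ts with
  | _ N ih =>
    match ts with
    | [] => exact nil
    | .node cs :: ts =>
      refine cons cs ts (ih _ ?_ _ rfl)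
      simp only [numNodesList, numNodes, numNodesList_append] at h ⊢
      omega

theorem numNodes_pos (T : PlaneTree) : 1 ≤ T.numNodes := by
  cases T; simp [numNodes]

theorem numNodesList_cons (cs ts : List PlaneTree) :
    numNodesList (.node cs :: ts) = 1 + numNodesList (cs ++ ts) := by
  simp [numNodesList, numNodes, numNodesList_append, add_assoc]

theorem degSeqList_cons (cs ts : List PlaneTree) :
    degSeqList (.node cs :: ts) = cs.length :: degSeqList (cs ++ ts) := by
  simp [degSeqList, degSeq, degSeqList_append]

theorem length_degSeqList (ts : List PlaneTree) : (degSeqList ts).length = numNodesList ts := by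
  induction ts using forest_induction with
  | nil => rfl
  | cons cs ts ih => rw [degSeqList_cons, numNodesList_cons, List.length_cons, ih, add_comm]

theorem sum_degSeqList (ts : List PlaneTree) :
    (degSeqList ts).sum + ts.length = numNodesList ts := by
  induction ts using forest_induction with
  | nil => rfl
  | cons cs ts ih =>
    rw [degSeqList_cons, numNodesList_cons, List.sum_cons, List.length_cons, ← ih,
      List.length_append]
    omega

theorem degSeqList_singleton (T : PlaneTree) : degSeqList [T] = T.degSeq := by
  simp [degSeqList]

theorem numNodesList_singleton (T : PlaneTree) : numNodesList [T] = T.numNodes := by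
  simp [numNodesList]

theorem siblingGroupsList_append (ts us : List PlaneTree) (p j : ℕ) :
    siblingGroupsList (ts ++ us) p j =
      siblingGroupsList ts p (j + us.length) ++
        siblingGroupsList us (p + (numNodesList ts - ts.length)) j := by
  induction ts generalizing p with
  | nil => simp [siblingGroupsList, numNodesList]
  | cons T ts ih =>
    have h1 := T.numNodes_pos
    have h2 := sum_degSeqList ts
    have h3 : p + (T.numNodes - 1) + (numNodesList ts - ts.length) =
      p + (numNodesList (T :: ts) - (T :: ts).length) := by
      simp only [numNodesList, List.length_cons]; omega
    simp only [List.cons_append, siblingGroupsList, ih, h3, List.length_append, List.append_assoc]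
    congr 2
    omega

/-- The subtrees `cs` together use one position for each of their nodes, roots included, before the
search returns to `ts`. This brings the recursion into the form required by `forest_induction`. -/
theorem siblingGroupsList_cons (cs ts : List PlaneTree) (p j : ℕ) :
    siblingGroupsList (.node cs :: ts) p j =
      (p, j + ts.length, cs.length) :: siblingGroupsList (cs ++ ts) (p + cs.length) j := by
  have h2 := sum_degSeqList cs
  have h3 : p + cs.length + (numNodesList cs - cs.length) = p + numNodesList cs := by omega
  simp [siblingGroupsList, siblingGroups, siblingGroupsList_append, numNodes, h3]

/-- When the node in depth-first position `l` becomes active, the positions used after `p` are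
counted by the preceding degrees. The exponent is `e` plus the number of nodes still waiting: roots
and successors found so far, less the `l + 1` nodes that have been active. -/
theorem mem_siblingGroupsList (ts : List PlaneTree) (p e i j k : ℕ) :
    (i, j, k) ∈ siblingGroupsList ts p e ↔
      ∃ l, (degSeqList ts)[l]? = some k ∧ i = p + ((degSeqList ts).take l).sum ∧
        j + l + 1 = e + ts.length + ((degSeqList ts).take l).sum := by
  induction ts using forest_induction generalizing p with
  | nil => simp [siblingGroupsList, degSeqList]
  | cons cs ts ih =>
    rw [siblingGroupsList_cons, List.mem_cons, ih, degSeqList_cons]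
    constructor
    · rintro (h | ⟨l, h1, h2, h3⟩)
      · simp only [Prod.mk.injEq] at h
        obtain ⟨rfl, rfl, rfl⟩ := h
        exact ⟨0, by simp, by simp, by simp [add_assoc]⟩
      · refine ⟨l + 1, by simpa using h1, ?_, ?_⟩
        · simp only [List.take_succ_cons, List.sum_cons]; omega
        · simp only [List.take_succ_cons, List.sum_cons, List.length_cons, List.length_append]
            at h3 ⊢
          omega
    · rintro ⟨_ | l, h1, h2, h3⟩
      · left
        simp only [List.getElem?_cons_zero, Option.some.injEq, List.take_zero, List.sum_nil,
          List.length_cons] at h1 h2 h3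
        simp only [Prod.mk.injEq]
        omega
      · right
        refine ⟨l, by simpa using h1, ?_, ?_⟩
        · simp only [List.take_succ_cons, List.sum_cons] at h2; omega
        · simp only [List.take_succ_cons, List.sum_cons, List.length_cons, List.length_append]
            at h3 ⊢
          omega

/-- The ballot condition: a node must have been found before it is active, so the waiting list is
never exhausted early. -/
theorem le_sum_take_degSeqList (ts : List PlaneTree) {l : ℕ} (hl : l < numNodesList ts) :
    l + 1 ≤ ts.length + ((degSeqList ts).take l).sum := by
  induction ts using forest_induction generalizing l with
  | nil => simp [numNodesList] at hl
  | cons cs ts ih =>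
    rw [degSeqList_cons]
    rw [numNodesList_cons] at hl
    cases l with
    | zero => simp
    | succ l =>
      have := ih (l := l) (by omega)
      simp only [List.take_succ_cons, List.sum_cons, List.length_cons, List.length_append] at this ⊢
      omega

/-- The plane forest with a given degree sequence. -/
def ofDegSeq : List ℕ → List PlaneTree
  | [] => []
  | d :: ds => .node ((ofDegSeq ds).take d) :: (ofDegSeq ds).drop d

theorem ofDegSeq_degSeqList (ts : List PlaneTree) : ofDegSeq (degSeqList ts) = ts := by
  induction ts using forest_induction with
  | nil => rfl
  | cons cs ts ih => rw [degSeqList_cons, ofDegSeq, ih]; simp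

theorem degSeq_injective : Function.Injective degSeq := fun T T' h => by
  have := congrArg ofDegSeq h
  rw [← degSeqList_singleton, ← degSeqList_singleton, ofDegSeq_degSeqList,
    ofDegSeq_degSeqList] at this
  simpa using this

/-- The ballot condition is also sufficient. Deleting the first degree `d` leaves a word for a
forest with `s - 1 + d` roots, the first `d` of which become the successors of the new root. -/
theorem degSeqList_ofDegSeq (ds : List ℕ) (s : ℕ) (hs : s + ds.sum = ds.length)
    (h : ∀ l < ds.length, l + 1 ≤ s + (ds.take l).sum) :
    (ofDegSeq ds).length = s ∧ degSeqList (ofDegSeq ds) = ds := by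
  induction ds generalizing s with
  | nil => simpa [ofDegSeq, degSeqList] using hs.symm
  | cons d ds ih =>
    have h0 := h 0 (by simp)
    simp only [List.take_zero, List.sum_nil, List.sum_cons, List.length_cons] at h0 hs
    obtain ⟨h1, h2⟩ := ih (s - 1 + d) (by omega) (fun l hl => by
      have := h (l + 1) (by simpa using hl)
      simp only [List.take_succ_cons, List.sum_cons] at this
      omega)
    constructor
    · simp [ofDegSeq, h1]; omega
    · rw [ofDegSeq, degSeqList_cons, List.take_append_drop, h2, List.length_take, h1]
      simp

end PlaneTree

-- Consecutive blocks with given lengths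

/-- The index of the block containing `p` when `ℕ` is cut into consecutive blocks of lengths
`ds`. -/
def level : List ℕ → ℕ → ℕ
  | [], _ => 0
  | d :: ds, p => if p < d then 0 else level ds (p - d) + 1

theorem level_lt_iff (ds : List ℕ) {p : ℕ} (hp : p < ds.sum) (l : ℕ) :
    level ds p < l ↔ p < (ds.take l).sum := by
  induction ds generalizing p l with
  | nil => simp at hp
  | cons d ds ih =>
    cases l with
    | zero => simp
    | succ l =>
      rw [level, List.take_succ_cons, List.sum_cons]
      split_ifs with h
      · exact ⟨fun _ => by omega, fun _ => by omega⟩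
      · rw [Nat.add_lt_add_iff_right, ih (by rw [List.sum_cons] at hp; omega)]
        omega

theorem level_eq_iff (ds : List ℕ) {p : ℕ} (hp : p < ds.sum) (l : ℕ) :
    level ds p = l ↔ (ds.take l).sum ≤ p ∧ p < (ds.take (l + 1)).sum := by
  have h1 := level_lt_iff ds hp l
  have h2 := level_lt_iff ds hp (l + 1)
  omega

theorem sum_take_succ_getD (ds : List ℕ) (l : ℕ) :
    (ds.take (l + 1)).sum = (ds.take l).sum + ds.getD l 0 := by
  induction ds generalizing l with
  | nil => simp
  | cons d ds ih =>
    cases l with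
    | zero => simp
    | succ l =>
      rw [List.take_succ_cons, List.sum_cons, ih, List.take_succ_cons, List.sum_cons,
        List.getD_cons_succ, add_assoc]

theorem card_level_eq (ds : List ℕ) (l : ℕ) :
    Fintype.card {p : Fin ds.sum // level ds p = l} = ds.getD l 0 := by
  have hle : (ds.take (l + 1)).sum ≤ ds.sum := by
    conv_rhs => rw [← List.take_append_drop (l + 1) ds, List.sum_append]
    omega
  rw [Fintype.card_subtype, ← Finset.card_map Fin.valEmbedding]
  have : Finset.map Fin.valEmbedding (Finset.univ.filter fun p : Fin ds.sum => level ds p = l) =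
      Finset.Ico (ds.take l).sum (ds.take (l + 1)).sum := by
    ext p
    simp only [Finset.mem_map, Finset.mem_filter, Finset.mem_univ, true_and, Fin.valEmbedding_apply,
      Finset.mem_Ico]
    constructor
    · rintro ⟨p, hp, rfl⟩
      exact (level_eq_iff ds p.2 l).1 hp
    · intro h
      exact ⟨⟨p, by omega⟩, (level_eq_iff ds (by omega) l).2 h, rfl⟩
  rw [this, Nat.card_Ico, sum_take_succ_getD]
  omega

end CayleyPolytope

-- Cells: volume, vertices, and common faces

namespace CayleyPolytope

open MeasureTheory Set

/-- The decreasing vectors whose `p`-th coordinate lies in `[q ^ (a p + 1), q ^ (a p)]`. -/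
def cell {n : ℕ} (q : ℝ) (a : Fin n → ℕ) : Set (Fin n → ℝ) :=
  {y | Antitone y ∧ ∀ p, q ^ (a p + 1) ≤ y p ∧ y p ≤ q ^ (a p)}

theorem isClosed_antitone (n : ℕ) : IsClosed {y : Fin n → ℝ | Antitone y} := by
  simp only [Antitone, ofPred_forall]
  exact isClosed_iInter fun p => isClosed_iInter fun r => isClosed_iInter fun _ =>
    isClosed_le (continuous_apply r) (continuous_apply p)

theorem cell_eq_inter {n : ℕ} (q : ℝ) (a : Fin n → ℕ) :
    cell q a = {y | Antitone y} ∩ Icc (fun p => q ^ (a p + 1)) (fun p => q ^ (a p)) := by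
  ext y
  simp [cell, Pi.le_def, forall_and]

theorem isCompact_cell {n : ℕ} (q : ℝ) (a : Fin n → ℕ) : IsCompact (cell q a) := by
  rw [cell_eq_inter]
  exact isCompact_Icc.inter_left (isClosed_antitone n)

theorem convex_cell {n : ℕ} (q : ℝ) (a : Fin n → ℕ) : Convex ℝ (cell q a) := by
  rw [cell_eq_inter]
  refine Convex.inter ?_ (convex_Icc _ _)
  intro y hy z hz c d hc hd _ p r h
  have h1 := hy h
  have h2 := hz h
  simp only [Pi.add_apply, Pi.smul_apply, smul_eq_mul]
  gcongr

theorem volume_setOf_apply_eq_apply {n : ℕ} {p r : Fin n} (h : p ≠ r) :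
    volume {y : Fin n → ℝ | y p = y r} = 0 := by
  let φ : (Fin n → ℝ) →ₗ[ℝ] ℝ :=
    LinearMap.proj (R := ℝ) (φ := fun _ : Fin n => ℝ) p -
      LinearMap.proj (R := ℝ) (φ := fun _ : Fin n => ℝ) r
  have hφ : ∀ y, φ y = y p - y r := fun _ => rfl
  have h1 := Measure.addHaar_submodule (volume : Measure (Fin n → ℝ)) (LinearMap.ker φ) (by
    intro h2
    have h3 : (Pi.single p 1 : Fin n → ℝ) ∈ LinearMap.ker φ := by rw [h2]; trivial
    rw [LinearMap.mem_ker, hφ] at h3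
    simp [Pi.single_eq_of_ne h.symm] at h3)
  convert h1 using 2
  ext y
  rw [mem_ofPred_eq, SetLike.mem_coe, LinearMap.mem_ker, hφ, sub_eq_zero]

theorem volume_setOf_not_injective (n : ℕ) :
    volume {y : Fin n → ℝ | ¬ Function.Injective y} = 0 := by
  have : {y : Fin n → ℝ | ¬ Function.Injective y} ⊆
      ⋃ p : Fin n, ⋃ r : Fin n, ⋃ _ : p ≠ r, {y | y p = y r} := by
    intro y hy
    simp only [Function.Injective, mem_ofPred_eq, not_forall] at hy
    obtain ⟨p, r, h1, h2⟩ := hy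
    simp only [mem_iUnion]
    exact ⟨p, r, h2, h1⟩
  refine measure_mono_null this ?_
  simp only [measure_iUnion_null_iff]
  exact fun p r h => volume_setOf_apply_eq_apply h

theorem volume_setOf_apply_eq {n : ℕ} (p : Fin n) (c : ℝ) :
    volume {y : Fin n → ℝ | y p = c} = 0 :=
  Measure.pi_hyperplane (fun _ : Fin n => (volume : Measure ℝ)) p c

theorem measurePreserving_comp_perm {n : ℕ} (σ : Equiv.Perm (Fin n)) :
    MeasurePreserving (fun y : Fin n → ℝ => y ∘ σ) volume volume :=
  volume_preserving_arrowCongr' σ.symm (MeasurableEquiv.refl ℝ) (MeasurePreserving.id _)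

/-- Sorting a point of the box `∏ [q^(a p+1), q^(a p)]` permutes coordinates only within the blocks
of `a`. Hence the box is tiled, up to null sets, by copies of the cell, one for each permutation
fixing `a`. -/
theorem volume_cell {n : ℕ} {q : ℝ} (hq : 0 < q) (hq1 : q ≤ 1) {a : Fin n → ℕ}
    (ha : Monotone a) :
    ((∏ i ∈ Finset.univ.image a, (Fintype.card {p // a p = i}).factorial : ℕ) : ℝ) *
      volume.real (cell q a) = ∏ p, (q ^ (a p) - q ^ (a p + 1)) := by
  classical
  have hle : (fun p => q ^ (a p + 1)) ≤ (fun p => q ^ (a p)) :=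
    fun p => pow_le_pow_of_le_one hq.le hq1 (Nat.le_succ _)
  -- The product of factorials is the order of the stabilizer of `a`.
  rw [← DomMulAct.stabilizer_card', Fintype.card_subtype]
  set s : Finset (Equiv.Perm (Fin n)) := Finset.univ.filter fun g => a ∘ g = a with hs
  set B : Set (Fin n → ℝ) := Icc (fun p => q ^ (a p + 1)) (fun p => q ^ (a p)) with hB
  have hmp : ∀ σ : Equiv.Perm (Fin n),
      volume ((fun y : Fin n → ℝ => y ∘ σ) ⁻¹' cell q a) = volume (cell q a) := fun σ =>
    (measurePreserving_comp_perm σ).measure_preimage (isCompact_cell q a).nullMeasurableSet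
  have hU : volume (⋃ σ ∈ s, (fun y : Fin n → ℝ => y ∘ σ) ⁻¹' cell q a) =
      ∑ σ ∈ s, volume ((fun y : Fin n → ℝ => y ∘ σ) ⁻¹' cell q a) := by
    refine measure_biUnion_finset₀ ?_ fun σ _ =>
      ((isCompact_cell q a).nullMeasurableSet).preimage
        (measurePreserving_comp_perm σ).quasiMeasurePreserving
    intro σ _ τ _ hne
    refine measure_mono_null ?_ (volume_setOf_not_injective n)
    rintro y ⟨h1, h2⟩ hy
    have := Tuple.unique_antitone h1.1 h2.1
    exact hne (Equiv.ext fun p => hy (congrFun this p))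
  have hBU : volume B = volume (⋃ σ ∈ s, (fun y : Fin n → ℝ => y ∘ σ) ⁻¹' cell q a) := by
    apply le_antisymm
    -- Off the null set `Z` no coordinate is a power of `q`, so the value of a coordinate determines
    -- its block.
    · set Z : Set (Fin n → ℝ) := ⋃ p, ⋃ i, {y : Fin n → ℝ | y p = q ^ i} with hZ
      have hZ0 : volume Z = 0 := by
        simp only [hZ, measure_iUnion_null_iff]
        exact fun p i => volume_setOf_apply_eq p _
      have : B ⊆ (⋃ σ ∈ s, (fun y : Fin n → ℝ => y ∘ σ) ⁻¹' cell q a) ∪ Z := by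
        intro y hy
        by_cases hyZ : y ∈ Z
        · exact Or.inr hyZ
        left
        simp only [hZ, mem_iUnion, mem_ofPred_eq, not_exists] at hyZ
        set σ := Tuple.sort (fun p => - y p) with hσ
        have hanti : Antitone (y ∘ σ) := fun p r h => by
          have := Tuple.monotone_sort (fun p => - y p) h
          simpa using this
        have hmono : Monotone (a ∘ σ) := by
          intro p r h
          by_contra! hlt
          have h1 := hanti h
          simp only [Function.comp_apply] at h1 hlt
          have h2 := hy.2 (σ p)
          have h3 := hy.1 (σ r)
          have h4 : q ^ a (σ p) ≤ q ^ (a (σ r) + 1) := pow_le_pow_of_le_one hq.le hq1 hlt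
          exact hyZ (σ p) (a (σ p)) (le_antisymm h2 (h4.trans (h3.trans h1)))
        -- Two increasing rearrangements of `a` coincide, so the sorting permutation fixes `a`.
        have heq : a ∘ σ = a := Tuple.unique_monotone (τ := Equiv.refl _) hmono ha
        simp only [mem_iUnion]
        refine ⟨σ, by simp [hs, heq], hanti, fun p => ?_⟩
        have h5 : a (σ p) = a p := congrFun heq p
        rw [← h5]
        exact ⟨hy.1 (σ p), hy.2 (σ p)⟩
      calc volume B ≤ _ := measure_mono this
        _ ≤ _ := measure_union_le _ _
        _ = _ := by rw [hZ0, add_zero]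
    · refine measure_mono (iUnion₂_subset fun σ hσ y hy => ?_)
      have heq : a ∘ σ = a := by simpa [hs] using hσ
      have key : ∀ p, q ^ (a p + 1) ≤ y p ∧ y p ≤ q ^ (a p) := fun p => by
        have h1 := hy.2 (σ.symm p)
        have h2 : a (σ (σ.symm p)) = a (σ.symm p) := congrFun heq _
        rw [← h2] at h1
        simpa using h1
      exact ⟨fun p => (key p).1, fun p => (key p).2⟩
  rw [hU, Finset.sum_congr rfl fun σ _ => hmp σ, Finset.sum_const, nsmul_eq_mul] at hBU
  have := congrArg ENNReal.toReal hBU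
  rw [hB, Real.volume_Icc_pi_toReal hle, ENNReal.toReal_mul, ENNReal.toReal_natCast] at this
  exact this.symm

/-- Pushing a vector away from, or towards, the ends of an interval keeps it in each cell. -/
theorem perturb_mem_cell {n : ℕ} {q : ℝ} (hq : 0 < q) (hq1 : q ≤ 1) {a : Fin n → ℕ}
    {y : Fin n → ℝ} (hy : y ∈ cell q a) (i : ℕ) {ε : ℝ} (hε : |ε| ≤ 1 / 2) :
    (fun p => y p + ε * max 0 (min (y p - q ^ (i + 1)) (q ^ i - y p))) ∈ cell q a := by
  obtain ⟨hε1, hε2⟩ := abs_le.1 hε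
  have hb : ∀ {c d : ℝ}, 0 ≤ c → c ≤ d → -d ≤ ε * c ∧ ε * c ≤ d := fun hc hcd =>
    ⟨by nlinarith, by nlinarith⟩
  constructor
  · intro p r h
    have h1 := hy.1 h
    set g : ℝ → ℝ := fun s => max 0 (min (s - q ^ (i + 1)) (q ^ i - s))
    -- The displacement `g` is 1-Lipschitz, so adding `ε * g` with `|ε| < 1` preserves the order of
    -- the coordinates.
    have h2 : |g (y p) - g (y r)| ≤ y p - y r := by
      have e : |y p - y r| = y p - y r := abs_of_nonneg (by linarith)
      refine (abs_max_sub_max_le_max _ _ _ _).trans (max_le (by simpa using h1) ?_)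
      refine (abs_min_sub_min_le_max _ _ _ _).trans (max_le ?_ ?_)
      · rw [sub_sub_sub_cancel_right, e]
      · rw [sub_sub_sub_cancel_left, abs_sub_comm, e]
    obtain ⟨h3, h4⟩ := abs_le.1 h2
    change y r + ε * g (y r) ≤ y p + ε * g (y p)
    nlinarith
  · intro p
    beta_reduce
    obtain ⟨h1, h2⟩ := hy.2 p
    rcases lt_trichotomy i (a p) with h | h | h
    · have : q ^ a p ≤ q ^ (i + 1) := pow_le_pow_of_le_one hq.le hq1 h
      rw [max_eq_left ((min_le_left _ _).trans (by linarith : y p - q ^ (i + 1) ≤ 0))]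
      simpa using hy.2 p
    · subst h
      have h0 : 0 ≤ min (y p - q ^ (a p + 1)) (q ^ a p - y p) :=
        le_min (by linarith) (by linarith)
      rw [max_eq_right h0]
      have h3 := hb h0 (min_le_left _ _)
      have h4 := hb h0 (min_le_right _ _)
      constructor <;> linarith
    · have : q ^ i ≤ q ^ (a p + 1) := pow_le_pow_of_le_one hq.le hq1 h
      rw [max_eq_left ((min_le_right _ _).trans (by linarith : q ^ i - y p ≤ 0))]
      simpa using hy.2 p

/-- A point is the midpoint of its two perturbations with `ε = ±1/2`. If it is extreme, both are
trivial, which forces each coordinate to an end of its interval. -/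
theorem extremePoints_cell_subset {n : ℕ} {q : ℝ} (hq : 0 < q) (hq1 : q ≤ 1) (a : Fin n → ℕ) :
    (cell q a).extremePoints ℝ ⊆ Set.pi univ fun p => {q ^ (a p + 1), q ^ a p} := by
  intro y hy p _
  obtain ⟨hyc, hy⟩ := mem_extremePoints.1 hy
  have h1 := perturb_mem_cell hq hq1 hyc (a p) (ε := 1 / 2) (by norm_num [abs_of_pos])
  have h2 := perturb_mem_cell hq hq1 hyc (a p) (ε := -(1 / 2)) (by norm_num [abs_of_pos])
  have h3 := (hy _ h1 _ h2 ⟨1 / 2, 1 / 2, by norm_num, by norm_num, by norm_num, by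
    ext r; simp only [Pi.add_apply, Pi.smul_apply, smul_eq_mul]; ring⟩).1
  have h4 := congrFun h3 p
  simp only [add_eq_left, mul_eq_zero] at h4
  have h5 := h4.resolve_left (by norm_num)
  obtain ⟨h6, h7⟩ := hyc.2 p
  rw [max_eq_right (le_min (by linarith) (by linarith))] at h5
  rcases min_choice (y p - q ^ (a p + 1)) (q ^ a p - y p) with h | h <;> rw [h] at h5
  · left; linarith
  · right; simp only [mem_singleton_iff]; linarith

theorem pow_mem_cell {n : ℕ} {q : ℝ} (hq : 0 < q) (hq1 : q ≤ 1) {a : Fin n → ℕ}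
    (ha : Monotone a) : (fun p => q ^ a p) ∈ cell q a :=
  ⟨fun _ _ h => pow_le_pow_of_le_one hq.le hq1 (ha h), fun _ =>
    ⟨pow_le_pow_of_le_one hq.le hq1 (Nat.le_succ _), le_rfl⟩⟩

/-- By Krein–Milman the cell is the closed hull of its extreme points. There are finitely many of
these, so their hull is already closed. -/
theorem isPolytope_cell {n : ℕ} {q : ℝ} (hq : 0 < q) (hq1 : q ≤ 1) {a : Fin n → ℕ}
    (ha : Monotone a) : IsPolytope (cell q a) := by
  have hfin : ((cell q a).extremePoints ℝ).Finite :=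
    (Set.Finite.pi' fun p => (toFinite {q ^ (a p + 1), q ^ a p})).subset
      ((extremePoints_cell_subset hq hq1 a).trans fun y hy p => hy p trivial)
  refine ⟨_, hfin, (isCompact_cell q a).extremePoints_nonempty ⟨_, pow_mem_cell hq hq1 ha⟩, ?_⟩
  rw [← (hfin.isClosed_convexHull ℝ).closure_eq,
    closure_convexHull_extremePoints (isCompact_cell q a) (convex_cell q a)]

theorem IsPolytope.preimage {E F : Type} [AddCommGroup E] [Module ℝ E] [AddCommGroup F]
    [Module ℝ F] {P : Set F} (hP : IsPolytope P) (e : E ≃ₗ[ℝ] F) : IsPolytope (e ⁻¹' P) := by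
  obtain ⟨S, h1, h2, rfl⟩ := hP
  refine ⟨e.symm '' S, h1.image _, h2.image _, ?_⟩
  rw [← LinearEquiv.coe_coe e.symm, ← LinearMap.image_convexHull]
  ext x
  simp only [LinearEquiv.coe_coe, mem_preimage, mem_image]
  exact ⟨fun h => ⟨_, h, by simp⟩, by rintro ⟨y, hy, rfl⟩; simpa using hy⟩

theorem apply_eq_of_mem_cell_of_mem_cell {n : ℕ} {q : ℝ} (hq : 0 < q) (hq1 : q ≤ 1)
    {a b : Fin n → ℕ} {p : Fin n} (h : a p < b p) {y : Fin n → ℝ} (ha : y ∈ cell q a) (hb : y ∈ cell q b) :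
    y p = q ^ (a p + 1) :=
  le_antisymm ((hb.2 p).2.trans (pow_le_pow_of_le_one hq.le hq1 h)) (ha.2 p).1

theorem volume_cell_inter_cell {n : ℕ} {q : ℝ} (hq : 0 < q) (hq1 : q ≤ 1) {a b : Fin n → ℕ}
    (h : a ≠ b) : volume (cell q a ∩ cell q b) = 0 := by
  obtain ⟨p, hp⟩ := Function.ne_iff.1 h
  rcases lt_or_gt_of_ne hp with hp | hp
  · exact measure_mono_null (fun y hy => apply_eq_of_mem_cell_of_mem_cell hq hq1 hp hy.1 hy.2)
      (volume_setOf_apply_eq p _)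
  · exact measure_mono_null (fun y hy => apply_eq_of_mem_cell_of_mem_cell hq hq1 hp hy.2 hy.1)
      (volume_setOf_apply_eq p _)

/-- The corner `q ^ a p` of one cell lies in the other, and for `q < 1` this compares the exponents.
-/
theorem eq_of_cell_eq {n : ℕ} {q : ℝ} (hq : 0 < q) (hq1 : q < 1) {a b : Fin n → ℕ}
    (ha : Monotone a) (hb : Monotone b) (h : cell q a = cell q b) : a = b := by
  have key : ∀ {a b : Fin n → ℕ}, Monotone a → cell q a = cell q b → ∀ p, b p ≤ a p := by
    intro a b ha h p
    have h1 := ((h ▸ pow_mem_cell hq hq1.le ha : _ ∈ cell q b).2 p).2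
    exact (pow_le_pow_iff_right_of_lt_one₀ hq hq1).1 h1
  exact funext fun p => le_antisymm (key hb h.symm p) (key ha h p)

theorem exists_functional_cell {n : ℕ} {q : ℝ} (hq : 0 < q) (hq1 : q ≤ 1) (a b : Fin n → ℕ)
    (hne : (cell q a ∩ cell q b).Nonempty) :
    ∃ l : (Fin n → ℝ) →L[ℝ] ℝ,
      cell q a ∩ cell q b = {y ∈ cell q a | ∀ z ∈ cell q a, l z ≤ l y} := by
  -- The signs push a point of the cell of `a` towards the cell of `b`: upwards where `b` has the
  -- smaller exponent, downwards where it has the larger one.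
  set l : (Fin n → ℝ) →L[ℝ] ℝ :=
    ∑ p, ((if b p < a p then 1 else if a p < b p then -1 else 0 : ℝ)) •
      (ContinuousLinearMap.proj p : (Fin n → ℝ) →L[ℝ] ℝ) with hl
  have hlap : ∀ y, l y = ∑ p, (if b p < a p then 1 else if a p < b p then -1 else 0 : ℝ) * y p := by
    intro y
    simp only [hl, sum_apply, smul_apply, ContinuousLinearMap.proj_apply,
      smul_eq_mul]
  set f : (Fin n → ℝ) → Fin n → ℝ :=
    fun y p => (if b p < a p then 1 else if a p < b p then -1 else 0 : ℝ) * y p with hf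
  have hmax : ∀ y ∈ cell q a ∩ cell q b, ∀ z ∈ cell q a, ∀ p, f z p ≤ f y p := by
    intro y hy z hz p
    have hz1 := hz.2 p
    simp only [hf]
    split_ifs with h1 h2
    · have := apply_eq_of_mem_cell_of_mem_cell hq hq1 h1 hy.2 hy.1
      have h3 := (hy.1.2 p).1
      have h4 := pow_le_pow_of_le_one hq.le hq1 (Nat.succ_le_of_lt h1)
      simp only [Nat.succ_eq_add_one] at h4
      linarith
    · have := apply_eq_of_mem_cell_of_mem_cell hq hq1 h2 hy.1 hy.2
      linarith
    · simp
  obtain ⟨w, hw⟩ := hne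
  refine ⟨l, Subset.antisymm (fun y hy => ⟨hy.1, fun z hz => ?_⟩) fun y hy => ⟨hy.1, hy.1.1, ?_⟩⟩
  · rw [hlap, hlap]
    exact Finset.sum_le_sum fun p _ => hmax y hy z hz p
  · intro p
    have h1 := hy.2 w hw.1
    rw [hlap, hlap] at h1
    -- The common point `w` maximizes every summand, so a maximizer `y` of the sum agrees with `w`
    -- wherever `a` and `b` differ.
    have h2 := (Finset.sum_eq_sum_iff_of_le fun p _ => hmax w hw y hy.1 p).1
      (le_antisymm (Finset.sum_le_sum fun p _ => hmax w hw y hy.1 p) h1) p (Finset.mem_univ _)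
    have hwb := hw.2.2 p
    have hya := hy.1.2 p
    simp only [hf] at h2
    split_ifs at h2 with h3 h4
    · rw [one_mul, one_mul] at h2; rwa [h2]
    · have : y p = w p := by linarith
      rwa [this]
    · have : a p = b p := by omega
      rwa [← this]

end CayleyPolytope

-- Plane trees as increasing vectors below the diagonal

namespace CayleyPolytope

open MeasureTheory Set

theorem level_mono (ds : List ℕ) {p r : ℕ} (h : p ≤ r) (hr : r < ds.sum) :
    level ds p ≤ level ds r := by
  have h1 := (level_lt_iff ds hr (level ds r + 1)).1 (Nat.lt_succ_self _)
  have h2 := (level_lt_iff ds (h.trans_lt hr) (level ds r + 1)).2 (h.trans_lt h1)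
  omega

/-- The vectors `(a 0, …, a (n - 1))` with `a 0 ≤ ⋯ ≤ a (n - 1)` and `a p ≤ p`. -/
def park (n : ℕ) : Finset (Fin n → ℕ) :=
  open Classical in (Fintype.piFinset fun p : Fin n => Finset.range (p + 1)).filter Monotone

theorem mem_park {n : ℕ} {a : Fin n → ℕ} : a ∈ park n ↔ (∀ p, a p ≤ p) ∧ Monotone a := by
  simp [park]

namespace PlaneTree

theorem sum_degSeq {n : ℕ} {T : PlaneTree} (hT : T.numNodes = n + 1) : T.degSeq.sum = n := by
  have := sum_degSeqList [T]
  rw [degSeqList_singleton, numNodesList_singleton, hT] at this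
  simpa using this

theorem length_degSeq (T : PlaneTree) : T.degSeq.length = T.numNodes := by
  rw [← degSeqList_singleton, length_degSeqList, numNodesList_singleton]

theorem le_sum_take_degSeq {n : ℕ} {T : PlaneTree} (hT : T.numNodes = n + 1) {l : ℕ}
    (hl : l ≤ n) : l ≤ (T.degSeq.take l).sum := by
  have := le_sum_take_degSeqList [T] (l := l) (by rw [numNodesList_singleton]; omega)
  rw [degSeqList_singleton, List.length_singleton] at this
  omega

/-- The blocks of the coordinates of `T`: the coordinates in the block `l` belong to the
successors of the node that comes in position `l` in depth-first order. -/
def block (n : ℕ) (T : PlaneTree) (p : Fin n) : ℕ := level T.degSeq p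

theorem block_mem_park {n : ℕ} {T : PlaneTree} (hT : T.numNodes = n + 1) :
    T.block n ∈ park n := by
  have hs := sum_degSeq hT
  refine mem_park.2 ⟨fun p => ?_, fun p r h => level_mono _ h (by omega)⟩
  have h1 := le_sum_take_degSeq hT (l := p + 1) p.2
  exact Nat.lt_succ_iff.1 ((level_lt_iff T.degSeq (by omega) (p + 1)).2 (by omega))

theorem card_block_eq {n : ℕ} {T : PlaneTree} (hT : T.numNodes = n + 1) (l : ℕ) :
    Fintype.card {p : Fin n // T.block n p = l} = T.degSeq.getD l 0 := by
  have hs := sum_degSeq hT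
  subst hs
  exact card_level_eq _ _

theorem eq_of_block_eq {n : ℕ} {T T' : PlaneTree} (hT : T.numNodes = n + 1)
    (hT' : T'.numNodes = n + 1) (h : T.block n = T'.block n) : T = T' := by
  apply degSeq_injective
  apply List.ext_getElem
  · rw [length_degSeq, length_degSeq, hT, hT']
  · intro l h1 h2
    have h3 := card_block_eq hT l
    have h4 := card_block_eq hT' l
    simp only [h] at h3
    rw [h4, List.getD_eq_getElem _ _ h1, List.getD_eq_getElem _ _ h2] at h3
    exact h3.symm

/-- The fibre sizes of `a` serve as degrees. At least `l` indices have `a p < l`, because `a p ≤ p`;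
this is the ballot condition for a single root. -/
theorem exists_block_eq {n : ℕ} {a : Fin n → ℕ} (ha : a ∈ park n) :
    ∃ T : PlaneTree, T.numNodes = n + 1 ∧ T.block n = a := by
  obtain ⟨hle, hmono⟩ := mem_park.1 ha
  set d : ℕ → ℕ := fun l => (Finset.univ.filter fun p => a p = l).card with hd
  set ds := (List.range (n + 1)).map d with hds
  have htake : ∀ l ≤ n + 1, (ds.take l).sum = (Finset.univ.filter fun p => a p < l).card := by
    intro l hl
    rw [hds, ← List.map_take, List.take_range, min_eq_left hl]
    clear hl
    induction l with
    | zero => simp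
    | succ l ih =>
      rw [List.range_succ, List.map_append, List.sum_append, ih, List.map_singleton,
        List.sum_singleton, ← Finset.card_union_of_disjoint]
      · congr 1
        ext p
        simp only [Finset.mem_union, Finset.mem_filter, Finset.mem_univ, true_and]
        omega
      · rw [Finset.disjoint_filter]
        intros; omega
  have hlen : ds.length = n + 1 := by simp [hds]
  have hsum : ds.sum = n := by
    have := htake (n + 1) le_rfl
    rw [← hlen, List.take_length] at this
    rw [this, Finset.filter_true_of_mem, Finset.card_univ, Fintype.card_fin]
    intro p _
    have := hle p
    omega
  have hval : ∀ l < ds.length, l + 1 ≤ 1 + (ds.take l).sum := by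
    intro l hl
    rw [hlen] at hl
    rw [htake l hl.le]
    have h1 : (Finset.univ.filter fun p : Fin n => (p : ℕ) < l) ⊆
        Finset.univ.filter fun p => a p < l := by
      intro p
      simp only [Finset.mem_filter, Finset.mem_univ, true_and]
      have := hle p
      omega
    have h2 := Finset.card_le_card h1
    rw [Fin.card_filter_val_lt] at h2
    omega
  obtain ⟨h1, h2⟩ := degSeqList_ofDegSeq ds 1 (by omega) hval
  obtain ⟨T, hT⟩ := List.length_eq_one_iff.1 h1
  rw [hT, degSeqList_singleton] at h2
  refine ⟨T, by rw [← length_degSeq, h2, hlen], funext fun p => ?_⟩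
  -- As `a` is increasing, `{r | a r < l}` is an initial segment, and its size is the partial sum
  -- that decides `level ds p < l`.
  have key : ∀ l ≤ n + 1, level ds p < l ↔ a p < l := by
    intro l hl
    rw [level_lt_iff ds (by omega), htake l hl]
    have h3 : (Finset.univ.filter fun r => a r < l).card ≤ n := by
      simpa using Finset.card_le_univ (Finset.univ.filter fun r => a r < l)
    constructor
    · intro h
      by_contra! h4
      have h5 : (Finset.univ.filter fun r => a r < l) ⊆
          Finset.univ.filter fun r : Fin n => (r : ℕ) < p := by
        intro r
        simp only [Finset.mem_filter, Finset.mem_univ, true_and]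
        intro h6
        by_contra! h7
        have := hmono (show p ≤ r from h7)
        omega
      have h6 := Finset.card_le_card h5
      rw [Fin.card_filter_val_lt] at h6
      omega
    · intro h
      have h5 : (Finset.univ.filter fun r : Fin n => (r : ℕ) < p + 1) ⊆
          Finset.univ.filter fun r => a r < l := by
        intro r
        simp only [Finset.mem_filter, Finset.mem_univ, true_and]
        intro h6
        exact (hmono (show r ≤ p from Nat.lt_succ_iff.1 h6)).trans_lt h
      have h6 := Finset.card_le_card h5
      rw [Fin.card_filter_val_lt] at h6
      omega
  rw [block, h2]
  have h3 := key (a p) (by have := hle p; omega)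
  have h4 := key (a p + 1) (by have := hle p; omega)
  omega

end PlaneTree

-- Rescaling, and the identification of both kinds of polytopes with cells

/-- The change of coordinates that multiplies `x₁, …, xₙ` by `q, …, qⁿ`. -/
noncomputable def scale (n : ℕ) (q : ℝ) : (Fin n → ℝ) →ₗ[ℝ] (Fin n → ℝ) :=
  Matrix.toLin' (Matrix.diagonal fun p => q ^ ((p : ℕ) + 1))

theorem scale_apply {n : ℕ} (q : ℝ) (x : Fin n → ℝ) (p : Fin n) :
    scale n q x p = q ^ ((p : ℕ) + 1) * x p := by
  simp [scale, Matrix.mulVec_diagonal]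

theorem det_scale (n : ℕ) (q : ℝ) :
    LinearMap.det (scale n q) = ∏ p : Fin n, q ^ ((p : ℕ) + 1) := by
  simp [scale]

theorem det_scale_pos (n : ℕ) {q : ℝ} (hq : 0 < q) : 0 < LinearMap.det (scale n q) := by
  rw [det_scale]
  positivity

theorem coord_succ {n : ℕ} (x : Fin n → ℝ) {i : ℕ} (h : i < n) : coord x (i + 1) = x ⟨i, h⟩ := by
  rw [coord, dif_pos ⟨by omega, by omega⟩]
  rfl

theorem antitone_of_succ_le {n : ℕ} {y : Fin n → ℝ}
    (h : ∀ (p : ℕ) (hp : p + 1 < n), y ⟨p + 1, hp⟩ ≤ y ⟨p, by omega⟩) : Antitone y := by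
  rintro ⟨p, hp⟩ ⟨r, hr⟩ hpr
  have hpr : p ≤ r := hpr
  induction r, hpr using Nat.le_induction with
  | base => exact le_rfl
  | succ r _ ih => exact (h r hr).trans (ih (by omega) ‹_›)

/-- Since `q * (1 + t) = 1`, the rescaling turns `x_i ≤ (1 + t) x_(i-1)` into `y_i ≤ y_(i-1)` and `1
≤ x_i` into `q^i ≤ y_i`. The bound `y ≤ 1` needs checking only for the first coordinate. -/
theorem mem_cayley_iff {n : ℕ} {t : ℝ} (ht : 0 ≤ t) (x : Fin n → ℝ) :
    x ∈ cayley n t ↔ Antitone (scale n (1 + t)⁻¹ x) ∧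
      ∀ p : Fin n, (1 + t)⁻¹ ^ ((p : ℕ) + 1) ≤ scale n (1 + t)⁻¹ x p ∧ scale n (1 + t)⁻¹ x p ≤ 1 := by
  have hr : 0 < 1 + t := by linarith
  set q := (1 + t)⁻¹ with hq
  have hq0 : 0 < q := inv_pos.2 hr
  have hqr : q * (1 + t) = 1 := inv_mul_cancel₀ hr.ne'
  have hlow : ∀ p : Fin n, q ^ ((p : ℕ) + 1) ≤ scale n q x p ↔ 1 ≤ x p := fun p => by
    rw [scale_apply, le_mul_iff_one_le_right (by positivity)]
  have hstep : ∀ (p : ℕ) (hp : p + 1 < n),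
      scale n q x ⟨p + 1, hp⟩ ≤ scale n q x ⟨p, by omega⟩ ↔
        x ⟨p + 1, hp⟩ ≤ (1 + t) * x ⟨p, by omega⟩ := fun p hp => by
    have e : q ^ (p + 1) * x ⟨p, by omega⟩ = q ^ (p + 1 + 1) * ((1 + t) * x ⟨p, by omega⟩) := by
      rw [pow_succ q (p + 1), mul_assoc, ← mul_assoc q, hqr, one_mul]
    rw [scale_apply, scale_apply, e, mul_le_mul_iff_right₀ (by positivity)]
  have hfirst : ∀ h : 0 < n, scale n q x ⟨0, h⟩ ≤ 1 ↔ x ⟨0, h⟩ ≤ 1 + t := fun h => by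
    rw [scale_apply, ← mul_le_mul_iff_right₀ hq0 (b := x _), hqr]
    simp
  constructor
  · rintro ⟨h1, h2⟩
    have hone : ∀ p : Fin n, 1 ≤ x p := by
      rintro ⟨_ | p, hp⟩
      · have := (h1 hp).1
        rwa [coord_succ x hp] at this
      · have := (h2 (p + 2) (by omega) hp).1
        rwa [coord_succ x hp] at this
    have hanti : Antitone (scale n q x) := antitone_of_succ_le fun p hp => by
      have := (h2 (p + 2) (by omega) hp).2
      rw [coord_succ x hp, Nat.add_sub_cancel (n := p + 1) (m := 1),
        coord_succ x (by omega : p < n)] at this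
      exact (hstep p hp).2 this
    refine ⟨hanti, fun p => ⟨(hlow p).2 (hone p), ?_⟩⟩
    have hn : 0 < n := by have := p.2; omega
    have := (h1 hn).2
    rw [coord_succ x hn] at this
    exact (hanti (show ⟨0, hn⟩ ≤ p from Nat.zero_le _)).trans ((hfirst hn).2 this)
  · rintro ⟨h1, h2⟩
    refine ⟨fun hn => ?_, fun i hi hin => ?_⟩
    · rw [coord_succ x (show 0 < n from hn)]
      exact ⟨(hlow _).1 (h2 _).1, (hfirst hn).1 (h2 _).2⟩
    · obtain ⟨p, rfl⟩ := Nat.exists_eq_add_of_le' hi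
      rw [coord_succ x (show p + 1 < n from hin), Nat.add_sub_cancel (n := p + 1) (m := 1),
        coord_succ x (by omega : p < n)]
      exact ⟨(hlow _).1 (h2 _).1, (hstep p hin).1 (h1 (Nat.le_succ p))⟩

theorem cayley_eq_biUnion (n : ℕ) {t : ℝ} (ht : 0 ≤ t) :
    cayley n t = ⋃ a ∈ park n, scale n (1 + t)⁻¹ ⁻¹' cell (1 + t)⁻¹ a := by
  have hr : 0 < 1 + t := by linarith
  have hq0 : 0 < (1 + t)⁻¹ := inv_pos.2 hr
  have hq1 : (1 + t)⁻¹ ≤ 1 := inv_le_one_of_one_le₀ (by linarith)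
  ext x
  rw [mem_cayley_iff ht]
  simp only [mem_iUnion, mem_preimage, exists_prop]
  set q := (1 + t)⁻¹
  set y := scale n q x
  constructor
  · rintro ⟨h1, h2⟩
    have hex : ∀ p, ∃ a, q ^ (a + 1) ≤ y p := fun p => ⟨p, (h2 p).1⟩
    classical
    -- The least exponent `a` with `q^(a+1) ≤ y p` is at most `p` by the lower bound on `y p`, and
    -- it increases with `p` because `y` decreases; minimality gives the upper bound of the cell.
    refine ⟨fun p => Nat.find (hex p), mem_park.2 ⟨fun p => Nat.find_min' _ (h2 p).1,
      fun p r h => Nat.find_min' _ ((Nat.find_spec (hex r)).trans (h1 h))⟩, h1,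
      fun p => ⟨Nat.find_spec (hex p), ?_⟩⟩
    change y p ≤ q ^ Nat.find (hex p)
    rcases h : Nat.find (hex p) with _ | k
    · simpa using (h2 p).2
    · exact (not_le.1 (Nat.find_min (hex p) (by omega : k < _))).le
  · rintro ⟨a, ha, h1, h2⟩
    refine ⟨h1, fun p => ⟨?_, (h2 p).2.trans (pow_le_one₀ hq0.le hq1)⟩⟩
    exact (pow_le_pow_of_le_one hq0.le hq1 (Nat.succ_le_succ ((mem_park.1 ha).1 p))).trans (h2 p).1

/-- The exponent at the node in position `l` exceeds the power of `q` in the rescaling by exactly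
the right amount for its chain to read `q^(l+1) ≤ ⋯ ≤ q^l` in the new coordinates. The order between
different blocks then comes for free, as a power of `q` separates them. -/
theorem treePolytope_eq {n : ℕ} {t : ℝ} (ht : 0 ≤ t) {T : PlaneTree} (hT : T.numNodes = n + 1) :
    treePolytope n T t = scale n (1 + t)⁻¹ ⁻¹' cell (1 + t)⁻¹ (T.block n) := by
  have hr : 0 < 1 + t := by linarith
  have hq0 : 0 < (1 + t)⁻¹ := inv_pos.2 hr
  have hq1 : (1 + t)⁻¹ ≤ 1 := inv_le_one_of_one_le₀ (by linarith)
  have hqr : (1 + t)⁻¹ * (1 + t) = 1 := inv_mul_cancel₀ hr.ne'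
  have hinv : ∀ m, (1 + t) ^ m = ((1 + t)⁻¹ ^ m)⁻¹ := fun m => by rw [inv_pow, inv_inv]
  have hsum := T.sum_degSeq hT
  ext x
  simp only [treePolytope, mem_ofPred_eq, mem_preimage]
  set q := (1 + t)⁻¹
  set ds := T.degSeq with hds
  set Y : ℕ → ℝ := fun i => q ^ (i + 1) * coord x (i + 1) with hY
  have hYs : ∀ p : Fin n, scale n q x p = Y p := fun p => by
    rw [scale_apply, hY]
    simp only [coord_succ x p.2]
  have hcond : (∀ i j k : ℕ, (i, j, k) ∈ T.siblingGroups 1 0 → 1 ≤ k →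
      1 ≤ coord x (i + k - 1) / (1 + t) ^ (j + k - 1) ∧
      (∀ m, m + 1 < k →
        coord x (i + m + 1) / (1 + t) ^ (j + m + 1) ≤ coord x (i + m) / (1 + t) ^ (j + m)) ∧
      coord x i / (1 + t) ^ j ≤ 1 + t) ↔
      ∀ l k, ds[l]? = some (k + 1) → q ^ (l + 1) ≤ Y ((ds.take l).sum + k) ∧
        (∀ m, m < k → Y ((ds.take l).sum + (m + 1)) ≤ Y ((ds.take l).sum + m)) ∧
        Y ((ds.take l).sum) ≤ q ^ l := by
    have hmem : ∀ i j k, (i, j, k) ∈ T.siblingGroups 1 0 ↔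
        ∃ l, ds[l]? = some k ∧ i = 1 + (ds.take l).sum ∧ j + l = (ds.take l).sum := by
      intro i j k
      have := PlaneTree.mem_siblingGroupsList [T] 1 0 i j k
      rw [PlaneTree.degSeqList_singleton] at this
      simp only [PlaneTree.siblingGroupsList, List.append_nil, List.length_nil, add_zero,
        List.length_singleton] at this
      rw [this]
      refine exists_congr fun l => and_congr_right fun _ => and_congr_right fun _ => ?_
      rw [← hds]
      omega
    -- All coordinates of one sibling group acquire the same factor `q^(l+1)`, since index minus
    -- exponent is constant along the group.
    have hval : ∀ c j l m : ℕ, j + l = c →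
        coord x (1 + c + m) / (1 + t) ^ (j + m) = Y (c + m) / q ^ (l + 1) := by
      intro c j l m h
      rw [hY, hinv, div_inv_eq_mul, eq_div_iff (by positivity)]
      simp only
      rw [show 1 + c + m = c + m + 1 by omega, show c + m + 1 = (j + m) + (l + 1) by omega, pow_add]
      ring
    have hq' : ∀ l, q ^ l = (1 + t) * q ^ (l + 1) := fun l => by
      rw [pow_succ, mul_left_comm, mul_comm (1 + t), hqr, mul_one]
    constructor
    · intro H l k hlk
      have hl : l ≤ n := by
        have := (List.getElem?_eq_some_iff.1 hlk).1
        rw [hds, PlaneTree.length_degSeq, hT] at this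
        omega
      have hj := PlaneTree.le_sum_take_degSeq hT hl
      obtain ⟨j, hj⟩ := Nat.exists_eq_add_of_le' hj
      obtain ⟨h1, h2, h3⟩ := H (1 + (ds.take l).sum) j (k + 1)
        ((hmem _ _ _).2 ⟨l, hlk, rfl, hj.symm⟩) (by omega)
      refine ⟨?_, fun m hm => ?_, ?_⟩
      · rw [← add_assoc, ← add_assoc, Nat.add_sub_cancel, Nat.add_sub_cancel,
          hval _ _ l _ hj.symm, le_div_iff₀ (by positivity), one_mul] at h1
        exact h1
      · have := h2 m (by omega)
        rw [add_assoc _ m 1, add_assoc _ m 1, hval _ _ l _ hj.symm, hval _ _ l _ hj.symm,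
          div_le_div_iff_of_pos_right (by positivity)] at this
        exact this
      · have e := hval _ _ l 0 hj.symm
        simp only [add_zero] at e
        rw [e, div_le_iff₀ (by positivity)] at h3
        rwa [hq']
    · intro H i j k hmem' hk
      obtain ⟨l, hlk, rfl, hj⟩ := (hmem i j k).1 hmem'
      obtain ⟨k, rfl⟩ := Nat.exists_eq_add_of_le' hk
      obtain ⟨h1, h2, h3⟩ := H l k hlk
      refine ⟨?_, fun m hm => ?_, ?_⟩
      · rw [← add_assoc, ← add_assoc, Nat.add_sub_cancel, Nat.add_sub_cancel,
          hval _ _ l _ hj, le_div_iff₀ (by positivity), one_mul]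
        exact h1
      · rw [add_assoc _ m 1, add_assoc _ m 1, hval _ _ l _ hj, hval _ _ l _ hj,
          div_le_div_iff_of_pos_right (by positivity)]
        exact h2 m (by omega)
      · have e := hval _ _ l 0 hj
        simp only [add_zero] at e
        rw [e, div_le_iff₀ (by positivity)]
        rwa [← hq']
  rw [hcond]
  have hget : ∀ l k, ds[l]? = some k → (ds.take (l + 1)).sum = (ds.take l).sum + k := by
    intro l k h
    rw [sum_take_succ_getD, List.getD_eq_getElem?_getD, h, Option.getD_some]
  constructor
  · intro H
    have key : ∀ p (hp : p < n), q ^ (level ds p + 1) ≤ Y p ∧ Y p ≤ q ^ level ds p ∧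
        (level ds (p + 1) = level ds p → p + 1 < n → Y (p + 1) ≤ Y p) := by
      intro p hp
      obtain ⟨h1, h2⟩ := (level_eq_iff ds (by omega) _).1 (rfl : level ds p = level ds p)
      set l := level ds p
      clear_value l
      rw [sum_take_succ_getD, List.getD_eq_getElem?_getD] at h2
      rcases hk : ds[l]? with _ | k
      · rw [hk] at h2; simp at h2; omega
      rw [hk, Option.getD_some] at h2
      obtain ⟨k, rfl⟩ := Nat.exists_eq_add_of_le' (show 1 ≤ k by omega)
      obtain ⟨h3, h4, h5⟩ := H l k hk
      have hchain : ∀ m m', m ≤ m' → m' ≤ k →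
          Y ((ds.take l).sum + m') ≤ Y ((ds.take l).sum + m) := by
        intro m m' h
        induction m', h using Nat.le_induction with
        | base => exact fun _ => le_rfl
        | succ m' _ ih => exact fun h => (h4 m' (by omega)).trans (ih (by omega))
      obtain ⟨m, rfl⟩ := Nat.exists_eq_add_of_le h1
      refine ⟨h3.trans (hchain m k (by omega) le_rfl), ?_, fun h6 h7 => ?_⟩
      · have := hchain 0 m (by omega) (by omega)
        exact this.trans h5
      · have h8 := ((level_eq_iff ds (by omega) _).1 h6).2
        rw [hget l _ hk] at h8
        exact h4 m (by omega)
    refine ⟨antitone_of_succ_le fun p hp => ?_, fun p => ?_⟩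
    · rw [hYs, hYs]
      obtain ⟨h1, h2, h3⟩ := key p (by omega)
      -- Inside a block the chain of the node applies; across a boundary, `q ^ (level ds p + 1)`
      -- lies between the two coordinates.
      rcases (level_mono ds (Nat.le_succ p) (by omega)).eq_or_lt with h | h
      · exact h3 h.symm hp
      · exact ((key (p + 1) hp).2.1.trans (pow_le_pow_of_le_one hq0.le hq1 h)).trans h1
    · rw [hYs]
      exact ⟨(key p p.2).1, (key p p.2).2.1⟩
  · rintro ⟨H1, H2⟩ l k hlk
    have hlt : (ds.take l).sum + (k + 1) ≤ n := by
      rw [← hget l _ hlk, ← hsum]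
      conv_rhs => rw [← List.take_append_drop (l + 1) ds, List.sum_append]
      omega
    have hlev : ∀ m, m ≤ k → q ^ (l + 1) ≤ Y ((ds.take l).sum + m) ∧
        Y ((ds.take l).sum + m) ≤ q ^ l := by
      intro m hm
      have h1 := H2 ⟨(ds.take l).sum + m, by omega⟩
      have h2 : T.block n ⟨(ds.take l).sum + m, by omega⟩ = l :=
        (level_eq_iff ds (by rw [hsum]; simp only; omega) l).2 ⟨by simp, by
          rw [hget l _ hlk]; simp only; omega⟩
      rwa [h2, hYs] at h1
    refine ⟨(hlev k le_rfl).1, fun m hm => ?_, (hlev 0 (by omega)).2⟩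
    have := H1 (show (⟨(ds.take l).sum + m, by omega⟩ : Fin n) ≤
      ⟨(ds.take l).sum + (m + 1), by omega⟩ from Nat.add_le_add_left (Nat.le_succ m) _)
    rwa [hYs, hYs] at this

end CayleyPolytope

-- Volumes and the polytopal subdivision

namespace CayleyPolytope

open MeasureTheory Set

theorem volume_scale_preimage {n : ℕ} {q : ℝ} (hq : 0 < q) (s : Set (Fin n → ℝ)) :
    volume (scale n q ⁻¹' s) =
      ENNReal.ofReal (∏ p : Fin n, q⁻¹ ^ ((p : ℕ) + 1)) * volume s := by
  have h := det_scale_pos n hq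
  rw [Measure.addHaar_preimage_linearMap _ h.ne', abs_of_pos (inv_pos.2 h), det_scale,
    ← Finset.prod_inv_distrib]
  simp only [inv_pow]

/-- A side of the box has length `q^a - q^(a+1) = t q^(a+1)`; undoing the rescaling multiplies it by
`(1+t)^(p+1)`, which leaves `t (1+t)^(p-a)`. -/
theorem prod_factorial_mul_volume_scale_cell {n : ℕ} {t : ℝ} (ht : 0 ≤ t) {a : Fin n → ℕ}
    (ha : a ∈ park n) :
    ((∏ i ∈ Finset.univ.image a, (Fintype.card {p // a p = i}).factorial : ℕ) : ℝ) *
      volume.real (scale n (1 + t)⁻¹ ⁻¹' cell (1 + t)⁻¹ a) =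
        t ^ n * (1 + t) ^ ∑ p : Fin n, ((p : ℕ) - a p) := by
  have hr : 0 < 1 + t := by linarith
  have hq0 : 0 < (1 + t)⁻¹ := inv_pos.2 hr
  have hq1 : (1 + t)⁻¹ ≤ 1 := inv_le_one_of_one_le₀ (by linarith)
  obtain ⟨hle, hmono⟩ := mem_park.1 ha
  rw [Measure.real, volume_scale_preimage hq0, ENNReal.toReal_mul,
    ENNReal.toReal_ofReal (by positivity), mul_left_comm]
  have := volume_cell hq0 hq1 hmono
  rw [Measure.real] at this
  rw [this, ← Finset.prod_mul_distrib, ← Finset.prod_pow_eq_pow_sum]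
  have hcard : t ^ n = ∏ _p : Fin n, t := by simp
  rw [hcard, ← Finset.prod_mul_distrib]
  refine Finset.prod_congr rfl fun p _ => ?_
  obtain ⟨d, hd⟩ := Nat.exists_eq_add_of_le (hle p)
  rw [inv_inv, hd, Nat.add_sub_cancel_left, inv_pow, inv_pow,
    show a p + d + 1 = d + (a p + 1) by omega, pow_add (1 + t) d, pow_succ]
  field_simp
  ring

theorem volume_scale_cell_ne_zero {n : ℕ} {t : ℝ} (ht : 0 < t) {a : Fin n → ℕ}
    (ha : a ∈ park n) : volume (scale n (1 + t)⁻¹ ⁻¹' cell (1 + t)⁻¹ a) ≠ 0 := by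
  intro h
  have := prod_factorial_mul_volume_scale_cell ht.le ha
  rw [Measure.real, h, ENNReal.toReal_zero, mul_zero] at this
  have : (0 : ℝ) < t ^ n * (1 + t) ^ ∑ p : Fin n, ((p : ℕ) - a p) := by positivity
  linarith

theorem affineSpan_eq_top_of_volume_ne_zero {n : ℕ} {s : Set (Fin n → ℝ)} (h : volume s ≠ 0) :
    affineSpan ℝ s = ⊤ := by
  by_contra h1
  exact h (measure_mono_null (subset_affineSpan ℝ s) (Measure.addHaar_affineSubspace _ _ h1))

theorem intrinsicInterior_subset_interior {n : ℕ} {s : Set (Fin n → ℝ)}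
    (h : affineSpan ℝ s = ⊤) : intrinsicInterior ℝ s ⊆ interior s := by
  refine interior_maximal intrinsicInterior_subset ?_
  have ho : IsOpen (affineSpan ℝ s : Set (Fin n → ℝ)) := by
    rw [h]; exact isOpen_univ
  exact ho.isOpenMap_subtype_val _ isOpen_interior

theorem lt_of_mem_interior_scale_cell {n : ℕ} {q : ℝ} (hq : 0 < q) {a : Fin n → ℕ}
    {x : Fin n → ℝ} (hx : x ∈ interior (scale n q ⁻¹' cell q a)) (p : Fin n) :
    q ^ (a p + 1) < scale n q x p ∧ scale n q x p < q ^ a p := by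
  set f : (Fin n → ℝ) →ₗ[ℝ] ℝ :=
    (LinearMap.proj (R := ℝ) (φ := fun _ : Fin n => ℝ) p).comp (scale n q)
  have hf : ∀ x, f x = scale n q x p := fun _ => rfl
  have hsurj : Function.Surjective f := fun c => by
    refine ⟨Pi.single p (c / q ^ ((p : ℕ) + 1)), ?_⟩
    rw [hf, scale_apply, Pi.single_eq_same]
    field_simp
  have hsub : scale n q ⁻¹' cell q a ⊆ f ⁻¹' Icc (q ^ (a p + 1)) (q ^ a p) :=
    fun y hy => hy.2 p
  have h1 := interior_mono hsub hx
  rw [← (f.isOpenMap_of_finiteDimensional hsurj).preimage_interior_eq_interior_preimage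
    f.continuous_of_finiteDimensional, interior_Icc] at h1
  exact h1

theorem isExposed_scale_cell {n : ℕ} {q : ℝ} (hq : 0 < q) (hq1 : q ≤ 1) (a b : Fin n → ℕ) :
    IsExposed ℝ (scale n q ⁻¹' cell q a)
      (scale n q ⁻¹' cell q a ∩ scale n q ⁻¹' cell q b) := by
  rintro ⟨x, hx⟩
  obtain ⟨l, hl⟩ := exists_functional_cell hq hq1 a b ⟨_, hx⟩
  set e := (scale n q).equivOfDetNeZero (det_scale_pos n hq).ne'
  have he : ∀ x, e x = scale n q x := fun _ => rfl
  refine ⟨l.comp (LinearMap.toContinuousLinearMap (scale n q)), ?_⟩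
  rw [← preimage_inter, hl]
  ext z
  simp only [mem_preimage, mem_ofPred_eq, ContinuousLinearMap.comp_apply,
    LinearMap.coe_toContinuousLinearMap']
  refine and_congr_right fun _ => ⟨fun h y hy => h _ hy, fun h y hy => ?_⟩
  have h1 := h (e.symm y) (by rw [← he, e.apply_symm_apply]; exact hy)
  rwa [← he (e.symm y), e.apply_symm_apply] at h1

theorem isPolytope_scale_cell {n : ℕ} {q : ℝ} (hq : 0 < q) (hq1 : q ≤ 1) {a : Fin n → ℕ}
    (ha : a ∈ park n) : IsPolytope (scale n q ⁻¹' cell q a) :=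
  (isPolytope_cell hq hq1 (mem_park.1 ha).2).preimage
    ((scale n q).equivOfDetNeZero (det_scale_pos n hq).ne')

theorem setOf_treePolytope_eq (n : ℕ) {t : ℝ} (ht : 0 ≤ t) :
    {D | ∃ T : PlaneTree, T.numNodes = n + 1 ∧ D = treePolytope n T t} =
      (fun a => scale n (1 + t)⁻¹ ⁻¹' cell (1 + t)⁻¹ a) '' (park n : Set (Fin n → ℕ)) := by
  ext D
  simp only [mem_ofPred_eq, mem_image, Finset.mem_coe]
  constructor
  · rintro ⟨T, hT, rfl⟩
    exact ⟨_, PlaneTree.block_mem_park hT, (treePolytope_eq ht hT).symm⟩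
  · rintro ⟨a, ha, rfl⟩
    obtain ⟨T, hT, rfl⟩ := PlaneTree.exists_block_eq ha
    exact ⟨T, hT, (treePolytope_eq ht hT).symm⟩

theorem isPolytopalSubdivision_cayley (n : ℕ) {t : ℝ} (ht : 0 ≤ t) :
    IsPolytopalSubdivision (cayley n t)
      {D | ∃ T : PlaneTree, T.numNodes = n + 1 ∧ D = treePolytope n T t} := by
  rw [setOf_treePolytope_eq n ht]
  have hr : 0 < 1 + t := by linarith
  have hq0 : 0 < (1 + t)⁻¹ := inv_pos.2 hr
  have hq1 : (1 + t)⁻¹ ≤ 1 := inv_le_one_of_one_le₀ (by linarith)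
  have hunion := cayley_eq_biUnion n ht
  -- For `t = 0` all cells collapse to the same set, so the volume arguments below are replaced by
  -- this equality.
  have hzero : t = 0 → ∀ a b : Fin n → ℕ, cell (1 + t)⁻¹ a = cell (1 + t)⁻¹ b := by
    rintro rfl a b
    simp [cell]
  refine ⟨(Finset.finite_toSet _).image _, ?_, ?_, ?_, ?_, ?_⟩
  · rintro _ ⟨a, ha, rfl⟩
    exact isPolytope_scale_cell hq0 hq1 ha
  · rintro _ ⟨a, ha, rfl⟩
    rcases ht.eq_or_lt with h0 | h0
    · congr 1
      rw [hunion]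
      refine Subset.antisymm (fun x hx => mem_biUnion ha hx) (iUnion₂_subset fun b _ => ?_)
      rw [hzero h0.symm b a]
    · have h1 := affineSpan_eq_top_of_volume_ne_zero (volume_scale_cell_ne_zero h0 ha)
      refine h1.trans (eq_top_iff.2 ?_).symm
      rw [← h1]
      refine affineSpan_mono ℝ ?_
      rw [hunion]
      exact fun x hx => mem_biUnion ha hx
  · rw [hunion, sUnion_image]
    rfl
  · rintro _ ⟨a, ha, rfl⟩ _ ⟨b, hb, rfl⟩ hne
    rcases ht.eq_or_lt with h0 | h0
    · exact absurd (by simp only [hzero h0.symm a b]) hne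
    rw [disjoint_left]
    intro x hxa hxb
    refine hne ?_
    have hxa' := lt_of_mem_interior_scale_cell hq0 (intrinsicInterior_subset_interior
      (affineSpan_eq_top_of_volume_ne_zero (volume_scale_cell_ne_zero h0 ha)) hxa)
    have hxb' := lt_of_mem_interior_scale_cell hq0 (intrinsicInterior_subset_interior
      (affineSpan_eq_top_of_volume_ne_zero (volume_scale_cell_ne_zero h0 hb)) hxb)
    -- Interior points satisfy the bounds strictly, so the exponent at each coordinate is
    -- determined.
    have hab : a = b := by
      funext p
      by_contra hp
      rcases lt_or_gt_of_ne hp with hp | hp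
      · have := pow_le_pow_of_le_one hq0.le hq1 (Nat.succ_le_of_lt hp)
        exact absurd ((hxa' p).1.trans ((hxb' p).2.trans_le this)) (lt_irrefl _)
      · have := pow_le_pow_of_le_one hq0.le hq1 (Nat.succ_le_of_lt hp)
        exact absurd ((hxb' p).1.trans ((hxa' p).2.trans_le this)) (lt_irrefl _)
    rw [hab]
  · rintro _ ⟨a, ha, rfl⟩ _ ⟨b, hb, rfl⟩
    refine ⟨isExposed_scale_cell hq0 hq1 a b, ?_⟩
    rw [inter_comm]
    exact isExposed_scale_cell hq0 hq1 b a

theorem isBounded_scale_cell {n : ℕ} {q : ℝ} (hq : 0 < q) (hq1 : q ≤ 1) {a : Fin n → ℕ}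
    (ha : a ∈ park n) : Bornology.IsBounded (scale n q ⁻¹' cell q a) := by
  obtain ⟨S, hS, -, h⟩ := isPolytope_scale_cell hq hq1 ha
  rw [h]
  exact (hS.isCompact_convexHull ℝ).isBounded

theorem injOn_treePolytope (n : ℕ) {t : ℝ} (ht : 0 < t) :
    InjOn (fun T : PlaneTree => treePolytope n T t) {T | T.numNodes = n + 1} := by
  have hr : 0 < 1 + t := by linarith
  have hq0 : 0 < (1 + t)⁻¹ := inv_pos.2 hr
  have hq1 : (1 + t)⁻¹ < 1 := inv_lt_one_of_one_lt₀ (by linarith)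
  intro T hT T' hT' h
  simp only at h
  rw [treePolytope_eq ht.le hT, treePolytope_eq ht.le hT'] at h
  have hsurj : Function.Surjective (scale n (1 + t)⁻¹) :=
    ((scale n (1 + t)⁻¹).equivOfDetNeZero (det_scale_pos n hq0).ne').surjective
  exact PlaneTree.eq_of_block_eq hT hT' (eq_of_cell_eq hq0 hq1
    (mem_park.1 (PlaneTree.block_mem_park hT)).2 (mem_park.1 (PlaneTree.block_mem_park hT')).2
    (hsurj.preimage_injective h))

theorem volume_cayley (n : ℕ) {t : ℝ} (ht : 0 ≤ t) :
    volume.real (cayley n t) =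
      ∑ a ∈ park n, volume.real (scale n (1 + t)⁻¹ ⁻¹' cell (1 + t)⁻¹ a) := by
  have hr : 0 < 1 + t := by linarith
  have hq0 : 0 < (1 + t)⁻¹ := inv_pos.2 hr
  have hq1 : (1 + t)⁻¹ ≤ 1 := inv_le_one_of_one_le₀ (by linarith)
  have hc : ∀ a, IsClosed (scale n (1 + t)⁻¹ ⁻¹' cell (1 + t)⁻¹ a) := fun a =>
    (isCompact_cell _ a).isClosed.preimage (scale n (1 + t)⁻¹).continuous_of_finiteDimensional
  rw [cayley_eq_biUnion n ht, measureReal_biUnion_finset₀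
    (h := fun a ha => (isBounded_scale_cell hq0 hq1 ha).measure_lt_top.ne)]
  · intro a _ b _ hne
    change volume (scale n (1 + t)⁻¹ ⁻¹' cell (1 + t)⁻¹ a ∩
      scale n (1 + t)⁻¹ ⁻¹' cell (1 + t)⁻¹ b) = 0
    rw [← preimage_inter, volume_scale_preimage hq0, volume_cell_inter_cell hq0 hq1 hne, mul_zero]
  · exact fun a _ => (hc a).measurableSet.nullMeasurableSet

-- The exponent of `1 + t` and the multinomial coefficient

/-- The sum of the entries of a list, weighted by their positions `1, 2, …`. -/
def weight : List ℕ → ℕ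
  | [] => 0
  | d :: ds => d + ds.sum + weight ds

/-- The total number of the waiting nodes when the nodes of a forest with `s` roots and degree
sequence `ds` become active one after the other. -/
def waitSum : ℕ → List ℕ → ℕ
  | _, [] => 0
  | s, d :: ds => (s - 1) + waitSum (s - 1 + d) ds

theorem weight_eq_sum (ds : List ℕ) :
    weight ds = ∑ l ∈ Finset.range ds.length, (l + 1) * ds.getD l 0 := by
  induction ds with
  | nil => simp [weight]
  | cons d ds ih =>
    have hsum : ds.sum = ∑ l ∈ Finset.range ds.length, ds.getD l 0 := by
      rw [Finset.sum_range, ← Fin.sum_univ_getElem]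
      exact Finset.sum_congr rfl fun l _ => by rw [List.getD_eq_getElem _ _ l.2]
    rw [weight, ih, hsum, List.length_cons, Finset.sum_range_succ', add_assoc,
      ← Finset.sum_add_distrib, add_comm]
    congr 1
    · refine Finset.sum_congr rfl fun l _ => ?_
      rw [List.getD_cons_succ]
      ring
    · simp

/-- Activating the first of `N` nodes lowers the two sums together by the waiting roots plus all
degrees, which is `N - 1`; and `C(N,2) = (N-1) + C(N-1,2)`. -/
theorem PlaneTree.waitSum_add_weight (ts : List PlaneTree) :
    waitSum ts.length (degSeqList ts) + weight (degSeqList ts) = (numNodesList ts).choose 2 := by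
  induction ts using forest_induction with
  | nil => rfl
  | cons cs ts ih =>
    have h := sum_degSeqList (.node cs :: ts)
    rw [degSeqList_cons, List.sum_cons, numNodesList_cons, List.length_cons] at h
    rw [List.length_append, add_comm cs.length] at ih
    rw [degSeqList_cons, numNodesList_cons, waitSum, weight, List.length_cons, Nat.add_sub_cancel,
      add_comm 1, Nat.choose_succ_succ' _ 1, Nat.choose_one_right, ← ih]
    omega

/-- Grouping coordinates by blocks gives `∑ i d_i = ∑ (block + 1)`, and the remaining sum is `∑ (p +
1)`. The bound `block ≤ p` makes the natural subtraction exact. -/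
theorem PlaneTree.sum_sub_block_add_weight {n : ℕ} {T : PlaneTree} (hT : T.numNodes = n + 1) :
    ∑ p : Fin n, ((p : ℕ) - T.block n p) + weight T.degSeq = (n + 1).choose 2 := by
  have hle := (mem_park.1 (block_mem_park hT)).1
  have hw : weight T.degSeq = ∑ p : Fin n, (T.block n p + 1) := by
    rw [weight_eq_sum, length_degSeq, hT, ← Finset.sum_fiberwise_of_maps_to (t := Finset.range (n + 1))
      (g := T.block n) (fun p _ => Finset.mem_range.2 (by have := hle p; omega))]
    refine Finset.sum_congr rfl fun l _ => ?_
    rw [Finset.sum_congr rfl (g := fun _ => l + 1) fun p hp => by rw [(Finset.mem_filter.1 hp).2],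
      Finset.sum_const, smul_eq_mul, mul_comm, ← card_block_eq hT, Fintype.card_subtype]
  rw [hw, ← Finset.sum_add_distrib, Nat.choose_two_right, ← Finset.sum_range_id_mul_two,
    Nat.mul_div_cancel _ two_pos, Finset.sum_range_succ']
  simp only [add_zero]
  rw [Finset.sum_range]
  refine Finset.sum_congr rfl fun p _ => ?_
  have := hle p
  omega

theorem PlaneTree.waitSum_degSeq {n : ℕ} {T : PlaneTree} (hT : T.numNodes = n + 1) :
    waitSum 1 T.degSeq = ∑ p : Fin n, ((p : ℕ) - T.block n p) := by
  have h1 := sum_sub_block_add_weight hT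
  have h2 := waitSum_add_weight [T]
  rw [degSeqList_singleton, numNodesList_singleton, hT, List.length_singleton] at h2
  omega

/-- A general commutative monoid allows one reindexing to serve for products and, through
`Multiplicative`, for sums. -/
theorem PlaneTree.prod_Icc_deg {M : Type*} [CommMonoid M] (T : PlaneTree) (n : ℕ)
    (f : ℕ → ℕ → M) :
    ∏ i ∈ Finset.Icc 1 (n + 1), f i (T.deg i) =
      ∏ l ∈ Finset.range (n + 1), f (l + 1) (T.degSeq.getD l 0) := by
  refine Finset.prod_nbij' (fun i => i - 1) (fun l => l + 1) ?_ ?_ ?_ ?_ ?_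
  · intro i hi
    simp only [Finset.mem_Icc, Finset.mem_range] at hi ⊢
    omega
  · intro l hl
    simp only [Finset.mem_Icc, Finset.mem_range] at hl ⊢
    omega
  · intro i hi
    simp only [Finset.mem_Icc] at hi
    omega
  · intro l _
    simp
  · intro i hi
    simp only [Finset.mem_Icc] at hi
    rw [PlaneTree.deg, Nat.sub_add_cancel hi.1]

theorem PlaneTree.prod_factorial_block {n : ℕ} {T : PlaneTree} (hT : T.numNodes = n + 1) :
    ∏ i ∈ Finset.univ.image (T.block n), (Fintype.card {p // T.block n p = i}).factorial =
      ∏ l ∈ Finset.range (n + 1), (T.degSeq.getD l 0).factorial := by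
  have hle := (mem_park.1 (block_mem_park hT)).1
  simp only [card_block_eq hT]
  refine Finset.prod_subset (fun l hl => ?_) fun l _ hl => ?_
  · obtain ⟨p, _, rfl⟩ := Finset.mem_image.1 hl
    have := hle p
    exact Finset.mem_range.2 (by omega)
  · rw [← card_block_eq hT, Fintype.card_eq_zero_iff.2, Nat.factorial_zero]
    exact ⟨fun p => hl (Finset.mem_image.2 ⟨p.1, Finset.mem_univ _, p.2⟩)⟩

theorem PlaneTree.prod_factorial_degSeq {n : ℕ} {T : PlaneTree} (hT : T.numNodes = n + 1) :
    (T.degSeq.map Nat.factorial).prod =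
      ∏ l ∈ Finset.range (n + 1), (T.degSeq.getD l 0).factorial := by
  rw [← hT, ← length_degSeq]
  induction T.degSeq with
  | nil => simp
  | cons d ds ih =>
    rw [List.map_cons, List.prod_cons, ih, List.length_cons, Finset.prod_range_succ', mul_comm]
    simp

theorem PlaneTree.sum_deg {n : ℕ} {T : PlaneTree} (hT : T.numNodes = n + 1) :
    ∑ i ∈ Finset.Icc 1 (n + 1), T.deg i = n := by
  have h := prod_Icc_deg (M := Multiplicative ℕ) T n fun _ d => Multiplicative.ofAdd d
  have h1 : ∑ i ∈ Finset.Icc 1 (n + 1), T.deg i =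
      ∑ l ∈ Finset.range (n + 1), T.degSeq.getD l 0 := h
  rw [h1, ← hT, ← length_degSeq]
  have h2 := sum_degSeq hT
  conv_rhs => rw [← h2]
  generalize T.degSeq = ds
  induction ds with
  | nil => simp
  | cons d ds ih =>
    rw [List.sum_cons, ← ih, List.length_cons, Finset.sum_range_succ', add_comm]
    simp

theorem PlaneTree.multinomial_deg_mul {n : ℕ} {T : PlaneTree} (hT : T.numNodes = n + 1) :
    (∏ l ∈ Finset.range (n + 1), (T.degSeq.getD l 0).factorial) *
      Nat.multinomial (Finset.Icc 1 (n + 1)) T.deg = n.factorial := by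
  have h := Nat.multinomial_spec (Finset.Icc 1 (n + 1)) T.deg
  rwa [prod_Icc_deg T n fun _ d => d.factorial, sum_deg hT] at h

theorem PlaneTree.choose_sub_sum_mul_deg {n : ℕ} {T : PlaneTree} (hT : T.numNodes = n + 1) :
    ((n + 1).choose 2 : ℤ) - ∑ i ∈ Finset.Icc 1 (n + 1), (i : ℤ) * (T.deg i : ℤ) =
      (waitSum 1 T.degSeq : ℕ) := by
  have h : ∑ i ∈ Finset.Icc 1 (n + 1), (i : ℤ) * (T.deg i : ℤ) =
      ∑ l ∈ Finset.range (n + 1), ((l + 1 : ℕ) : ℤ) * (T.degSeq.getD l 0 : ℤ) :=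
    prod_Icc_deg (M := Multiplicative ℤ) T n fun i d => Multiplicative.ofAdd ((i : ℤ) * d)
  have h1 := sum_sub_block_add_weight hT
  rw [← waitSum_degSeq hT, weight_eq_sum, length_degSeq, hT] at h1
  rw [h, ← h1]
  push_cast
  ring

end CayleyPolytope

-- Neighbors-first search

namespace CayleyPolytope

open Finset

theorem eraseList_eq_map {V : Type} (L : List (LabeledTree V)) :
    LabeledTree.eraseList L = L.map LabeledTree.erase := by
  induction L with
  | nil => rfl
  | cons T L ih => rw [LabeledTree.eraseList, ih, List.map_cons]

section Search

variable {V : Type} [LinearOrder V]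

theorem nfs_nil (G : SimpleGraph V) [DecidableRel G.Adj] (U : Finset V) : nfs G U [] = [] := by
  rw [nfs]

theorem nfs_cons (G : SimpleGraph V) [DecidableRel G.Adj] (U : Finset V) (v : V) (S : List V) :
    nfs G U (v :: S) =
      .node v ((nfs G (U \ U.filter (G.Adj v)) ((U.filter (G.Adj v)).sort (· ≤ ·) ++ S)).take
          (U.filter (G.Adj v)).card) ::
        (nfs G (U \ U.filter (G.Adj v)) ((U.filter (G.Adj v)).sort (· ≤ ·) ++ S)).drop
          (U.filter (G.Adj v)).card := by
  rw [nfs]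

/-- Induction along neighbors-first search. -/
theorem search_induction (G : SimpleGraph V) [DecidableRel G.Adj]
    {P : Finset V → List V → Prop} (nil : ∀ U, P U [])
    (cons : ∀ U v S, P (U \ U.filter (G.Adj v)) ((U.filter (G.Adj v)).sort (· ≤ ·) ++ S) →
      P U (v :: S)) (U : Finset V) (S : List V) : P U S := by
  induction h : U.card + S.length using Nat.strong_induction_on generalizing U S with
  | _ N ih =>
    match S with
    | [] => exact nil U
    | v :: S =>
      refine cons U v S (ih _ ?_ _ _ rfl)
      have h1 := card_sdiff_add_card_eq_card (filter_subset (G.Adj v) U)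
      simp only [List.length_append, length_sort, List.length_cons] at h ⊢
      omega

theorem length_nfs (G : SimpleGraph V) [DecidableRel G.Adj] (U : Finset V) (S : List V) :
    (nfs G U S).length = S.length := by
  induction U, S using search_induction G with
  | nil U => simp [nfs_nil]
  | cons U v S ih =>
    rw [List.length_append, length_sort] at ih
    rw [nfs_cons, List.length_cons, List.length_drop, ih, List.length_cons, Nat.add_sub_cancel_left]

/-- The search looks only at edges among unvisited and waiting nodes; edges at a node that has
already been active are invisible to it. -/
theorem nfs_congr (G G' : SimpleGraph V) [DecidableRel G.Adj] [DecidableRel G'.Adj]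
    (U : Finset V) (S : List V)
    (h : ∀ v ∈ U ∪ S.toFinset, ∀ w ∈ U ∪ S.toFinset, G.Adj v w ↔ G'.Adj v w) :
    nfs G U S = nfs G' U S := by
  induction U, S using search_induction G with
  | nil U => rw [nfs_nil, nfs_nil]
  | cons U v S ih =>
    have hN : U.filter (G.Adj v) = U.filter (G'.Adj v) :=
      filter_congr fun w hw => h v (by simp) w (by simp [hw])
    have hsub : U \ U.filter (G.Adj v) ∪ ((U.filter (G.Adj v)).sort (· ≤ ·) ++ S).toFinset ⊆
        U ∪ (v :: S).toFinset := by
      intro w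
      simp only [mem_union, mem_sdiff, List.toFinset_append, sort_toFinset, List.toFinset_cons,
        mem_insert, mem_filter]
      tauto
    have := ih fun a ha b hb => h a (hsub ha) b (hsub hb)
    rw [nfs_cons, nfs_cons, this, hN]

/-- `R` is the set of nodes never visited. The search is exhaustive: no edge joins `R` to a visited
node, and every visited node is reachable from a starting one. This links connectedness with the
number of nodes in the search tree, in both directions. -/
theorem exists_unvisited (G : SimpleGraph V) [DecidableRel G.Adj] (U : Finset V) (S : List V) :
    ∃ R ⊆ U, PlaneTree.numNodesList (LabeledTree.eraseList (nfs G U S)) + R.card =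
        U.card + S.length ∧
      (∀ v ∈ S, ∀ w ∈ R, ¬ G.Adj v w) ∧ (∀ v ∈ U, v ∉ R → ∀ w ∈ R, ¬ G.Adj v w) ∧
      ∀ w ∈ U, w ∉ R → ∃ s ∈ S, G.Reachable s w := by
  induction U, S using search_induction G with
  | nil U =>
    refine ⟨U, Subset.rfl, ?_, by simp, fun v h h' => absurd h h', fun v h h' => absurd h h'⟩
    simp [nfs_nil, LabeledTree.eraseList, PlaneTree.numNodesList]
  | cons U v S ih =>
    obtain ⟨R, hR, h1, h2, h3, h4⟩ := ih
    have hc := card_sdiff_add_card_eq_card (filter_subset (G.Adj v) U)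
    have hmemN : ∀ {w}, w ∈ U → w ∈ (U.filter (G.Adj v)).sort (· ≤ ·) ++ S ∨
        w ∈ U \ U.filter (G.Adj v) := by
      intro w hw
      by_cases hwN : w ∈ U.filter (G.Adj v)
      · exact Or.inl (List.mem_append_left _ ((mem_sort _).2 hwN))
      · exact Or.inr (mem_sdiff.2 ⟨hw, hwN⟩)
    refine ⟨R, hR.trans sdiff_subset, ?_, ?_, ?_, ?_⟩
    · rw [nfs_cons, eraseList_eq_map, List.map_cons, LabeledTree.erase,
        PlaneTree.numNodesList_cons, eraseList_eq_map, ← List.map_append, List.take_append_drop,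
        ← eraseList_eq_map, List.length_cons]
      rw [List.length_append, length_sort] at h1
      omega
    · intro s hs w hw
      rcases List.mem_cons.1 hs with rfl | hs
      · have := mem_sdiff.1 (hR hw)
        exact fun h => this.2 (mem_filter.2 ⟨this.1, h⟩)
      · exact h2 s (List.mem_append_right _ hs) w hw
    · intro x hx hxR w hw
      rcases hmemN hx with h | h
      · exact h2 x h w hw
      · exact h3 x h hxR w hw
    · intro w hw hwR
      have key : ∀ s ∈ (U.filter (G.Adj v)).sort (· ≤ ·) ++ S, G.Reachable s w →
          ∃ s ∈ v :: S, G.Reachable s w := by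
        intro s hs hsw
        rcases List.mem_append.1 hs with h | h
        · refine ⟨v, by simp, SimpleGraph.Reachable.trans ?_ hsw⟩
          exact (mem_filter.1 ((mem_sort _).1 h)).2.reachable
        · exact ⟨s, List.mem_cons_of_mem _ h, hsw⟩
      rcases hmemN hw with h | h
      · exact key w h (SimpleGraph.Reachable.refl w)
      · obtain ⟨s, hs, hsw⟩ := h4 w h hwR
        exact key s hs hsw

theorem eraseList_nfs_cons_eq_iff (G : SimpleGraph V) [DecidableRel G.Adj] (U : Finset V) (v : V)
    (S : List V) (cs ts : List PlaneTree) :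
    LabeledTree.eraseList (nfs G U (v :: S)) = .node cs :: ts ↔
      (U.filter (G.Adj v)).card = cs.length ∧
      LabeledTree.eraseList (nfs G (U \ U.filter (G.Adj v))
        ((U.filter (G.Adj v)).sort (· ≤ ·) ++ S)) = cs ++ ts := by
  rw [nfs_cons]
  set N := U.filter (G.Adj v)
  set L := nfs G (U \ N) (N.sort (· ≤ ·) ++ S)
  have hL : N.card ≤ L.length := by
    rw [length_nfs, List.length_append, length_sort]
    omega
  simp only [eraseList_eq_map, List.map_cons, LabeledTree.erase, List.cons.injEq,
    PlaneTree.node.injEq, List.map_take, List.map_drop]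
  constructor
  · rintro ⟨h1, h2⟩
    refine ⟨?_, by rw [← h1, ← h2, List.take_append_drop]⟩
    rw [← h1, List.length_take, List.length_map, min_eq_left hL]
  · rintro ⟨h1, h2⟩
    rw [h2, h1]
    simp

end Search

-- Adding a vertex to a graph

section Attach

variable {V : Type}

/-- The graph that is obtained from `G` by connecting `v` with the elements of `M`. -/
def attach (v : V) (M : Finset V) (G : SimpleGraph V) : SimpleGraph V :=
  G ⊔ SimpleGraph.fromRel fun a b => a = v ∧ b ∈ M

theorem attach_adj_self {v : V} {M : Finset V} {G : SimpleGraph V} (hM : v ∉ M)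
    (hG : v ∉ G.support) (w : V) : (attach v M G).Adj v w ↔ w ∈ M := by
  rw [attach, SimpleGraph.sup_adj, SimpleGraph.fromRel_adj]
  constructor
  · rintro (h | ⟨_, ⟨_, h⟩ | ⟨_, h⟩⟩)
    · exact absurd ((G.mem_support).2 ⟨w, h⟩) hG
    · exact h
    · exact absurd h hM
  · exact fun h => Or.inr ⟨fun e => hM (e ▸ h), Or.inl ⟨rfl, h⟩⟩

theorem attach_adj_of_ne {v a b : V} (M : Finset V) (G : SimpleGraph V) (ha : a ≠ v) (hb : b ≠ v) :
    (attach v M G).Adj a b ↔ G.Adj a b := by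
  simp [attach, ha, hb]

variable [Fintype V]

theorem ncard_edgeSet_attach {v : V} {M : Finset V} {G : SimpleGraph V} (hM : v ∉ M)
    (hG : v ∉ G.support) :
    (attach v M G).edgeSet.ncard = G.edgeSet.ncard + M.card := by
  have h : (attach v M G).edgeSet = G.edgeSet ∪ (fun w => s(v, w)) '' (M : Set V) := by
    ext e
    induction e with | _ a b => ?_
    simp only [SimpleGraph.mem_edgeSet, Set.mem_union, Set.mem_image, mem_coe, attach,
      SimpleGraph.sup_adj, SimpleGraph.fromRel_adj, Sym2.eq_iff]
    refine or_congr_right ⟨?_, ?_⟩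
    · rintro ⟨_, ⟨rfl, h⟩ | ⟨rfl, h⟩⟩
      · exact ⟨b, h, Or.inl ⟨rfl, rfl⟩⟩
      · exact ⟨a, h, Or.inr ⟨rfl, rfl⟩⟩
    · rintro ⟨w, h, ⟨rfl, rfl⟩ | ⟨rfl, rfl⟩⟩
      · exact ⟨fun e => hM (e ▸ h), Or.inl ⟨rfl, h⟩⟩
      · exact ⟨fun e => hM (e ▸ h), Or.inr ⟨rfl, h⟩⟩
  rw [h, Set.ncard_union_eq, Set.ncard_image_of_injective, Set.ncard_coe_finset]
  · intro a b hab
    have := by simpa using hab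
    exact this.elim id fun h => h.2.trans h.1
  · rw [Set.disjoint_left]
    rintro _ h1 ⟨w, _, rfl⟩
    exact hG ((G.mem_support).2 ⟨w, h1⟩)

open Classical in
-- A graph on `insert v W` amounts to a graph on `W` and a neighborhood of `v` in `W`. Encoding
-- graphs on `W` by their support keeps the vertex type fixed in inductions.
theorem sum_insert_vertex [DecidableEq V] {R : Type*} [AddCommMonoid R] {v : V} {W : Finset V}
    (hv : v ∉ W)
    (f : SimpleGraph V → R) :
    ∑ G : SimpleGraph V with G.support ⊆ ↑(insert v W), f G =
      ∑ M ∈ W.powerset, ∑ G : SimpleGraph V with G.support ⊆ ↑W, f (attach v M G) := by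
  rw [← sum_product']
  have hin : ∀ G : SimpleGraph V, ∀ v, G.support ⊆ (W : Set V) → v ∉ W → v ∉ G.support :=
    fun G v h1 h2 h3 => h2 (h1 h3)
  symm
  refine sum_nbij' (fun x => attach v x.1 x.2)
    (fun G => (W.filter (G.Adj v), G.deleteIncidenceSet v)) ?_ ?_ ?_ ?_ ?_
  · rintro ⟨M, G⟩ h
    simp only [mem_product, mem_powerset, mem_filter, mem_univ, true_and] at h ⊢
    intro a ha
    obtain ⟨b, hab⟩ := (SimpleGraph.mem_support _).1 ha
    rw [attach, SimpleGraph.sup_adj, SimpleGraph.fromRel_adj] at hab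
    rcases hab with h1 | ⟨_, ⟨h1, _⟩ | ⟨_, h1⟩⟩
    · exact mem_coe.2 (mem_insert_of_mem (h.2 ((G.mem_support).2 ⟨b, h1⟩)))
    · exact mem_coe.2 (h1 ▸ mem_insert_self _ _)
    · exact mem_coe.2 (mem_insert_of_mem (h.1 h1))
  · intro G h
    simp only [mem_product, mem_powerset, mem_filter, mem_univ, true_and] at h ⊢
    refine ⟨filter_subset _ _, ?_⟩
    intro a ha
    obtain ⟨b, hab⟩ := (SimpleGraph.mem_support _).1 ha
    rw [SimpleGraph.deleteIncidenceSet_adj] at hab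
    exact (mem_insert.1 (h ((G.mem_support).2 ⟨b, hab.1⟩))).resolve_left hab.2.1
  · rintro ⟨M, G⟩ h
    simp only [mem_product, mem_powerset, mem_filter, mem_univ, true_and] at h
    have hvG := hin G v h.2 hv
    have hvM : v ∉ M := fun h' => hv (h.1 h')
    refine Prod.ext ?_ ?_
    · ext w
      simp only [mem_filter, attach_adj_self hvM hvG]
      exact ⟨fun h' => h'.2, fun h' => ⟨h.1 h', h'⟩⟩
    · ext a b
      simp only [SimpleGraph.deleteIncidenceSet_adj]
      constructor
      · rintro ⟨h1, h2, h3⟩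
        exact (attach_adj_of_ne M G h2 h3).1 h1
      · intro h1
        have h2 : a ≠ v := fun e => hvG (e ▸ (G.mem_support).2 ⟨b, h1⟩)
        have h3 : b ≠ v := fun e => hvG (e ▸ (G.mem_support).2 ⟨a, h1.symm⟩)
        exact ⟨(attach_adj_of_ne M G h2 h3).2 h1, h2, h3⟩
  · intro G h
    simp only [mem_filter, mem_univ, true_and] at h
    have hvM : v ∉ W.filter (G.Adj v) := fun h' => hv (mem_filter.1 h').1
    have hvG : v ∉ (G.deleteIncidenceSet v).support := by
      rintro ⟨b, hb⟩
      exact ((G.deleteIncidenceSet_adj).1 hb).2.1 rfl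
    have hself : ∀ b, (attach v (W.filter (G.Adj v)) (G.deleteIncidenceSet v)).Adj v b ↔
        G.Adj v b := by
      intro b
      rw [attach_adj_self hvM hvG, mem_filter]
      refine ⟨fun h' => h'.2, fun h' => ⟨?_, h'⟩⟩
      exact (mem_insert.1 (h ((G.mem_support).2 ⟨v, h'.symm⟩))).resolve_left h'.ne'
    ext a b
    by_cases ha : a = v
    · rw [ha]; exact hself b
    by_cases hb : b = v
    · rw [hb, SimpleGraph.adj_comm, hself, SimpleGraph.adj_comm]
    rw [attach_adj_of_ne _ _ ha hb, SimpleGraph.deleteIncidenceSet_adj]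
    tauto
  · rintro ⟨M, G⟩ _
    rfl

theorem sum_powerset_union {α R : Type*} [DecidableEq α] [AddCommMonoid R] {A B : Finset α}
    (h : Disjoint A B) (f : Finset α → R) :
    ∑ M ∈ (A ∪ B).powerset, f M = ∑ M ∈ A.powerset, ∑ N ∈ B.powerset, f (M ∪ N) := by
  rw [← sum_product']
  rw [disjoint_left] at h
  symm
  refine sum_nbij' (fun x => x.1 ∪ x.2) (fun M => (M ∩ A, M ∩ B)) ?_ ?_ ?_ ?_ ?_
  · rintro ⟨M, N⟩ h1
    simp only [mem_product, mem_powerset] at h1 ⊢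
    exact union_subset_union h1.1 h1.2
  · intro M _
    simp only [mem_product, mem_powerset]
    exact ⟨inter_subset_right, inter_subset_right⟩
  · rintro ⟨M, N⟩ h1
    simp only [mem_product, mem_powerset] at h1
    refine Prod.ext ?_ ?_
    · ext x
      have := @h x
      have := @h1.1 x
      have := @h1.2 x
      simp only [mem_inter, mem_union]
      tauto
    · ext x
      have := @h x
      have := @h1.1 x
      have := @h1.2 x
      simp only [mem_inter, mem_union]
      tauto
  · intro M h1
    rw [mem_powerset] at h1
    simp only
    rw [← inter_union_distrib_left, inter_eq_left.2 h1]
  · rintro ⟨M, N⟩ _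
    rfl

end Attach

-- Counting graphs with a given search forest

section Count

variable {V : Type} [Fintype V] [LinearOrder V]

open Classical in
-- Induction along the search: the neighborhood of the first waiting node splits into a part `N` of
-- `U`, whose size is prescribed by the forest, and an arbitrary part `M` of `S`. Multiplying by the
-- factorials of the degrees avoids division.
theorem sum_eraseList_nfs_eq (t : ℝ) (ts : List PlaneTree) (U : Finset V) (S : List V)
    (hS : S.Nodup) (hU : Disjoint U S.toFinset) (hlen : S.length = ts.length)
    (hnum : PlaneTree.numNodesList ts = U.card + S.length) :
    (((PlaneTree.degSeqList ts).map Nat.factorial).prod : ℝ) *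
      ∑ G : SimpleGraph V with G.support ⊆ ↑(U ∪ S.toFinset),
        (if LabeledTree.eraseList (nfs G U S) = ts then t ^ G.edgeSet.ncard else 0) =
      t ^ U.card * (1 + t) ^ waitSum S.length (PlaneTree.degSeqList ts) * U.card.factorial := by
  induction ts using PlaneTree.forest_induction generalizing U S with
  | nil =>
    obtain rfl : S = [] := List.length_eq_zero_iff.1 hlen
    simp only [PlaneTree.numNodesList, List.length_nil] at hnum
    obtain rfl : U = ∅ := card_eq_zero.1 (by omega)
    have h : (univ.filter fun G : SimpleGraph V => G.support ⊆ ↑((∅ : Finset V) ∪ [].toFinset)) =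
        {⊥} := by
      ext G
      simp [Set.subset_empty_iff]
    rw [h, sum_singleton, nfs_nil]
    simp [LabeledTree.eraseList, PlaneTree.degSeqList, waitSum]
  | cons cs ts ih =>
    rcases S with _ | ⟨v, S⟩
    · simp at hlen
    simp only [List.length_cons, Nat.add_right_cancel_iff] at hlen
    rw [List.nodup_cons] at hS
    rw [List.toFinset_cons, disjoint_insert_right] at hU
    have hk : cs.length ≤ U.card := by
      have := PlaneTree.sum_degSeqList (cs ++ ts)
      rw [PlaneTree.numNodesList_cons, List.length_cons] at hnum
      rw [List.length_append] at this
      omega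
    have hv : v ∉ U ∪ S.toFinset := by
      rw [mem_union, List.mem_toFinset]
      exact fun h => h.elim hU.1 hS.1
    set W := U ∪ S.toFinset with hW
    have hWv : U ∪ (v :: S).toFinset = insert v W := by
      rw [List.toFinset_cons, union_insert]
    -- `M` affects only the number of edges, so its weight `t ^ M.card` factors out.
    have hterm : ∀ N ∈ U.powerset, ∀ M ∈ S.toFinset.powerset,
        ∑ G : SimpleGraph V with G.support ⊆ ↑W,
          (if LabeledTree.eraseList (nfs (attach v (N ∪ M) G) U (v :: S)) = .node cs :: ts
            then t ^ (attach v (N ∪ M) G).edgeSet.ncard else 0) =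
        t ^ M.card * (if N.card = cs.length then t ^ N.card *
          ∑ G : SimpleGraph V with G.support ⊆ ↑W,
            (if LabeledTree.eraseList (nfs G (U \ N) (N.sort (· ≤ ·) ++ S)) = cs ++ ts
              then t ^ G.edgeSet.ncard else 0) else 0) := by
      intro N hN M hM
      rw [mem_powerset] at hN hM
      have hNM : Disjoint N M := disjoint_of_subset_left hN (disjoint_of_subset_right hM hU.2)
      have hvNM : v ∉ N ∪ M := fun h => hv (union_subset_union hN hM h)
      have hfil : ∀ G : SimpleGraph V, G.support ⊆ ↑W →
          U.filter ((attach v (N ∪ M) G).Adj v) = N := by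
        intro G hG
        ext w
        rw [mem_filter, attach_adj_self hvNM fun h => hv (hG h), mem_union]
        have h1 := @hN w
        have h2 := @hM w
        have h3 : w ∈ U → w ∉ S.toFinset := fun h => disjoint_left.1 hU.2 h
        tauto
      have hsub : U \ N ∪ (N.sort (· ≤ ·) ++ S).toFinset ⊆ W := by
        intro w
        rw [hW]
        simp only [List.toFinset_append, sort_toFinset, mem_union, mem_sdiff]
        have h1 := @hN w
        tauto
      have hrest : ∀ G : SimpleGraph V, G.support ⊆ ↑W →
          nfs (attach v (N ∪ M) G) (U \ N) (N.sort (· ≤ ·) ++ S) =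
            nfs G (U \ N) (N.sort (· ≤ ·) ++ S) := fun G _ =>
        nfs_congr _ _ _ _ fun a ha b hb => attach_adj_of_ne _ _
          (fun e => hv (e ▸ hsub ha)) (fun e => hv (e ▸ hsub hb))
      have hiff : ∀ G : SimpleGraph V, G.support ⊆ ↑W →
          (LabeledTree.eraseList (nfs (attach v (N ∪ M) G) U (v :: S)) = .node cs :: ts ↔
            N.card = cs.length ∧
              LabeledTree.eraseList (nfs G (U \ N) (N.sort (· ≤ ·) ++ S)) = cs ++ ts) := by
        intro G hG
        rw [eraseList_nfs_cons_eq_iff, hfil G hG, hrest G hG]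
      by_cases hc : N.card = cs.length
      · rw [if_pos hc, mul_sum, mul_sum]
        refine sum_congr rfl fun G hG => ?_
        have hG := (mem_filter.1 hG).2
        simp only [hiff G hG, hc, true_and]
        split_ifs
        · rw [ncard_edgeSet_attach hvNM fun h => hv (hG h), card_union_of_disjoint hNM, pow_add,
            pow_add, hc]
          ring
        · simp
      · rw [if_neg hc, mul_zero]
        refine sum_eq_zero fun G hG => if_neg fun h => hc ((hiff G (mem_filter.1 hG).2).1 h).1
    have hih : ∀ N ∈ U.powerset,
        (((PlaneTree.degSeqList (cs ++ ts)).map Nat.factorial).prod : ℝ) *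
          (if N.card = cs.length then t ^ N.card *
            ∑ G : SimpleGraph V with G.support ⊆ ↑W,
              (if LabeledTree.eraseList (nfs G (U \ N) (N.sort (· ≤ ·) ++ S)) = cs ++ ts
                then t ^ G.edgeSet.ncard else 0) else 0) =
        if N.card = cs.length then
          t ^ U.card * (1 + t) ^ waitSum (S.length + cs.length) (PlaneTree.degSeqList (cs ++ ts)) *
            (U.card - cs.length).factorial else 0 := by
      intro N hN
      rw [mem_powerset] at hN
      split_ifs with hc
      · have hset : U \ N ∪ (N.sort (· ≤ ·) ++ S).toFinset = W := by
          rw [List.toFinset_append, sort_toFinset, ← union_assoc, sdiff_union_of_subset hN]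
        have hcard : (U \ N).card = U.card - cs.length := by
          rw [card_sdiff_of_subset hN, hc]
        have := ih (U \ N) (N.sort (· ≤ ·) ++ S) ?_ ?_ ?_ ?_
        · rw [hset, hcard, List.length_append, length_sort, hc, add_comm cs.length] at this
          rw [mul_left_comm, this, hc]
          rw [show t ^ U.card = t ^ cs.length * t ^ (U.card - cs.length) by
            rw [← pow_add, Nat.add_sub_cancel' hk]]
          ring
        · refine (sort_nodup _ _).append hS.2 ?_
          intro w h1 h2
          exact disjoint_left.1 hU.2 (hN ((mem_sort _).1 h1)) (List.mem_toFinset.2 h2)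
        · rw [List.toFinset_append, sort_toFinset, disjoint_union_right]
          exact ⟨sdiff_disjoint, disjoint_of_subset_left sdiff_subset hU.2⟩
        · rw [List.length_append, List.length_append, length_sort, hc, hlen]
        · rw [hcard, List.length_append, length_sort, hc]
          rw [PlaneTree.numNodesList_cons, List.length_cons] at hnum
          omega
      · rw [mul_zero]
    have hpow : ∑ M ∈ S.toFinset.powerset, t ^ M.card = (1 + t) ^ S.length := by
      have := sum_pow_mul_eq_add_pow t 1 S.toFinset
      simp only [one_pow, mul_one] at this
      rw [this, List.toFinset_card_of_nodup hS.2, add_comm]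
    -- The choices of `M` sum to `(1 + t) ^ S.length`. The choices of `N` give a binomial
    -- coefficient, which together with `cs.length !` and `(U.card - cs.length)!` makes `U.card !`.
    rw [hWv, sum_insert_vertex hv, hW, sum_powerset_union hU.2, ← hW,
      sum_congr rfl fun N hN => sum_congr rfl (hterm N hN)]
    simp only [← sum_mul]
    rw [← mul_sum, hpow, PlaneTree.degSeqList_cons, List.map_cons, List.prod_cons, Nat.cast_mul,
      mul_assoc, mul_left_comm _ ((1 + t) ^ S.length), mul_sum, sum_congr rfl hih, ← sum_filter,
      ← powersetCard_eq_filter, sum_const, card_powersetCard, nsmul_eq_mul, List.length_cons,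
      waitSum, Nat.add_sub_cancel, pow_add, ← Nat.choose_mul_factorial_mul_factorial hk]
    push_cast
    ring

end Count

-- Connected graphs and single search trees

section Connected

open Classical in
/-- The nodes with the maximal labels in the components. -/
noncomputable def roots {V : Type} [Fintype V] [LinearOrder V] (G : SimpleGraph V) : Finset V :=
  univ.filter fun r => ∀ w, G.Reachable r w → w ≤ r

theorem mem_roots {V : Type} [Fintype V] [LinearOrder V] {G : SimpleGraph V} {r : V} :
    r ∈ roots G ↔ ∀ w, G.Reachable r w → w ≤ r := by
  simp [roots]

open Classical in
theorem searchForest_eq {V : Type} [Fintype V] [LinearOrder V] (G : SimpleGraph V) :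
    searchForest G =
      ((roots G).sort (· ≥ ·)).flatMap fun r => nfs G (univ.erase r) [r] := rfl

variable {n : ℕ}

open Classical in
theorem planeForest_eq_of_connected {G : SimpleGraph (Fin (n + 1))} (hG : G.Connected) :
    planeForest G = LabeledTree.eraseList (nfs G (univ.erase (Fin.last n)) [Fin.last n]) := by
  have h : roots G = {Fin.last n} := by
    ext r
    rw [mem_roots, mem_singleton]
    refine ⟨fun h => Fin.last_le_iff.1 (h _ (hG.preconnected r _)), ?_⟩
    rintro rfl w _
    exact Fin.le_last w
  rw [planeForest, searchForest_eq, h, sort_singleton]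
  simp

open Classical in
-- Each component contributes exactly one tree, so a one-tree forest has only one component maximum,
-- and every node reaches it.
theorem connected_of_planeForest_eq {G : SimpleGraph (Fin (n + 1))} {T : PlaneTree}
    (h : planeForest G = [T]) : G.Connected := by
  have hlen := congrArg List.length h
  rw [planeForest, eraseList_eq_map, List.length_map, searchForest_eq, List.length_flatMap] at hlen
  simp only [length_nfs, List.length_singleton, List.map_const', List.sum_replicate, length_sort,
    smul_eq_mul, mul_one] at hlen
  obtain ⟨r, hr⟩ := card_eq_one.1 hlen
  have key : ∀ v, G.Reachable r v := by
    intro v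
    obtain ⟨m, hm, hmax⟩ := exists_max_image (univ.filter fun w => G.Reachable v w) id
      ⟨v, by simp⟩
    simp only [mem_filter, mem_univ, true_and, id] at hm hmax
    have : m ∈ roots G := mem_roots.2 fun w hw => hmax w (hm.trans hw)
    rw [hr, mem_singleton] at this
    exact this ▸ hm.symm
  exact (SimpleGraph.connected_iff _).2 ⟨fun v w => (key v).symm.trans (key w), ⟨r⟩⟩

open Classical in
theorem exists_planeForest_eq {G : SimpleGraph (Fin (n + 1))} (hG : G.Connected) :
    ∃ T : PlaneTree, T.numNodes = n + 1 ∧ planeForest G = [T] := by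
  rw [planeForest_eq_of_connected hG]
  obtain ⟨R, hR, h1, h2, h3, h4⟩ := exists_unvisited G (univ.erase (Fin.last n)) [Fin.last n]
  have hR0 : R = ∅ := by
    by_contra hne
    obtain ⟨w, hw⟩ := nonempty_iff_ne_empty.2 hne
    have key : ∀ x y, G.Reachable x y → x ∈ R → y ∈ R := by
      rintro x y ⟨p⟩
      induction p with
      | nil => exact id
      | @cons a b c hab _ ih =>
        intro ha
        refine ih ?_
        by_contra hb
        by_cases hbl : b = Fin.last n
        · exact h2 b (by simp [hbl]) a ha hab.symm
        · exact h3 b (mem_erase.2 ⟨hbl, mem_univ _⟩) hb a ha hab.symm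
    exact (mem_erase.1 (hR (key w (Fin.last n) (hG.preconnected _ _) hw))).1 rfl
  obtain ⟨T, hT⟩ : ∃ T, LabeledTree.eraseList (nfs G (univ.erase (Fin.last n)) [Fin.last n]) =
      [T] := by
    rw [← List.length_eq_one_iff, eraseList_eq_map, List.length_map, length_nfs,
      List.length_singleton]
  refine ⟨T, ?_, hT⟩
  rw [hT, hR0, PlaneTree.numNodesList_singleton, card_erase_of_mem (mem_univ _), card_univ,
    Fintype.card_fin] at h1
  simpa using h1

open Classical in
-- A search from the maximal node that yields `n + 1` nodes has visited everything, so connectedness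
-- need not be assumed and the count can run over all graphs.
theorem planeForest_eq_iff {T : PlaneTree} (hT : T.numNodes = n + 1)
    (G : SimpleGraph (Fin (n + 1))) :
    planeForest G = [T] ↔
      LabeledTree.eraseList (nfs G (univ.erase (Fin.last n)) [Fin.last n]) = [T] := by
  refine ⟨fun h => by rw [← planeForest_eq_of_connected (connected_of_planeForest_eq h), h],
    fun h => ?_⟩
  obtain ⟨R, hR, h1, h2, h3, h4⟩ := exists_unvisited G (univ.erase (Fin.last n)) [Fin.last n]
  rw [h, PlaneTree.numNodesList_singleton, hT, card_erase_of_mem (mem_univ _), card_univ,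
    Fintype.card_fin, List.length_singleton] at h1
  have hR0 : R = ∅ := card_eq_zero.1 (by omega)
  have key : ∀ w, G.Reachable (Fin.last n) w := by
    intro w
    by_cases hw : w = Fin.last n
    · rw [hw]
    · obtain ⟨s, hs, hsw⟩ := h4 w (mem_erase.2 ⟨hw, mem_univ _⟩) (by simp [hR0])
      rwa [List.mem_singleton.1 hs] at hsw
  have hG : G.Connected :=
    (SimpleGraph.connected_iff _).2 ⟨fun v w => (key v).symm.trans (key w), ⟨Fin.last n⟩⟩
  rw [planeForest_eq_of_connected hG, h]

open Classical in
theorem prod_factorial_mul_sum_planeForest_eq (t : ℝ) {T : PlaneTree} (hT : T.numNodes = n + 1) :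
    ((∏ l ∈ range (n + 1), (T.degSeq.getD l 0).factorial : ℕ) : ℝ) *
      ∑ G : SimpleGraph (Fin (n + 1)) with planeForest G = [T], t ^ G.edgeSet.ncard =
      t ^ n * (1 + t) ^ waitSum 1 T.degSeq * n.factorial := by
  have hcard : (univ.erase (Fin.last n)).card = n := by
    rw [card_erase_of_mem (mem_univ _), card_univ, Fintype.card_fin, Nat.add_sub_cancel]
  have h := sum_eraseList_nfs_eq t [T] (univ.erase (Fin.last n)) [Fin.last n]
    (List.nodup_singleton _) (by simp) rfl
    (by rw [PlaneTree.numNodesList_singleton, hT, hcard]; rfl)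
  have hun : univ.erase (Fin.last n) ∪ [Fin.last n].toFinset = univ := by
    ext w
    simp
  rw [PlaneTree.degSeqList_singleton, PlaneTree.prod_factorial_degSeq hT, hun, hcard, coe_univ,
    filter_true_of_mem fun G _ => Set.subset_univ _, ← sum_filter] at h
  rw [List.length_singleton] at h
  rw [← h]
  simp only [planeForest_eq_iff hT]

end Connected

end CayleyPolytope

-- The theorem

open scoped Nat in
open Classical CayleyPolytope MeasureTheory in
theorem theorem6p2 (n : ℕ) (t : ℝ) (ht : 0 ≤ t) :
    (∀ T : PlaneTree, T.numNodes = n + 1 →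
      IsPolytope (treePolytope n T t) ∧
      Bornology.IsBounded (treePolytope n T t) ∧
      (n ! : ℝ) * volume.real (treePolytope n T t) =
        ∑ G : SimpleGraph (Fin (n + 1)) with planeForest G = [T], t ^ G.edgeSet.ncard ∧
      ∑ G : SimpleGraph (Fin (n + 1)) with planeForest G = [T], t ^ G.edgeSet.ncard =
        t ^ n *
          (1 + t) ^ (((n + 1).choose 2 : ℤ) - ∑ i ∈ Finset.Icc 1 (n + 1), (i : ℤ) * (T.deg i : ℤ)) *
          (Nat.multinomial (Finset.Icc 1 (n + 1)) T.deg : ℝ)) ∧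
    IsPolytopalSubdivision (cayley n t)
      {D | ∃ T : PlaneTree, T.numNodes = n + 1 ∧ D = treePolytope n T t} ∧
    (0 < t → Set.InjOn (fun T : PlaneTree => treePolytope n T t) {T | T.numNodes = n + 1}) ∧
    (n ! : ℝ) * volume.real (cayley n t) =
      ∑ G : SimpleGraph (Fin (n + 1)) with G.Connected, t ^ G.edgeSet.ncard := by
  have hq0 : 0 < (1 + t)⁻¹ := inv_pos.2 (by linarith)
  have hq1 : (1 + t)⁻¹ ≤ 1 := inv_le_one_of_one_le₀ (by linarith)
  have hvol : ∀ T : PlaneTree, T.numNodes = n + 1 →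
      (n ! : ℝ) * volume.real (treePolytope n T t) =
        ∑ G : SimpleGraph (Fin (n + 1)) with planeForest G = [T], t ^ G.edgeSet.ncard := by
    intro T hT
    have h1 := prod_factorial_mul_volume_scale_cell ht (PlaneTree.block_mem_park hT)
    have h2 := prod_factorial_mul_sum_planeForest_eq t hT
    rw [PlaneTree.prod_factorial_block hT, ← treePolytope_eq ht hT,
      ← PlaneTree.waitSum_degSeq hT] at h1
    rw [← h1, mul_assoc] at h2
    -- Volume and graph sum carry the same product of factorials of the degrees, which cancels.
    have h3 := mul_left_cancel₀ (Nat.cast_ne_zero.2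
      (Finset.prod_ne_zero_iff.2 fun l _ => Nat.factorial_ne_zero _)) h2
    rw [h3, mul_comm]
  refine ⟨fun T hT => ⟨?_, ?_, hvol T hT, ?_⟩, isPolytopalSubdivision_cayley n ht,
    fun ht => injOn_treePolytope n ht, ?_⟩
  · rw [treePolytope_eq ht hT]
    exact isPolytope_scale_cell hq0 hq1 (PlaneTree.block_mem_park hT)
  · rw [treePolytope_eq ht hT]
    exact isBounded_scale_cell hq0 hq1 (PlaneTree.block_mem_park hT)
  · have h2 := prod_factorial_mul_sum_planeForest_eq t hT
    rw [← PlaneTree.multinomial_deg_mul hT, Nat.cast_mul, mul_left_comm] at h2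
    rw [PlaneTree.choose_sub_sum_mul_deg hT, zpow_natCast]
    exact mul_left_cancel₀ (Nat.cast_ne_zero.2
      (Finset.prod_ne_zero_iff.2 fun l _ => Nat.factorial_ne_zero _)) h2
  · have : Nonempty PlaneTree := ⟨.node []⟩
    choose! τ hτ1 hτ2 using fun (a : Fin n → ℕ) (ha : a ∈ park n) => PlaneTree.exists_block_eq ha
    rw [volume_cayley n ht, Finset.mul_sum]
    have h1 : ∀ a ∈ park n, (n ! : ℝ) * volume.real (scale n (1 + t)⁻¹ ⁻¹' cell (1 + t)⁻¹ a) =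
        ∑ G : SimpleGraph (Fin (n + 1)) with planeForest G = [τ a], t ^ G.edgeSet.ncard := by
      intro a ha
      rw [← hvol _ (hτ1 a ha), treePolytope_eq ht (hτ1 a ha), hτ2 a ha]
    -- The connected graphs are partitioned by their search trees, one class for each `a` in `park
    -- n`.
    rw [Finset.sum_congr rfl h1, ← Finset.sum_biUnion]
    · refine Finset.sum_congr ?_ fun _ _ => rfl
      ext G
      simp only [Finset.mem_biUnion, Finset.mem_filter, Finset.mem_univ, true_and]
      constructor
      · rintro ⟨a, _, h⟩
        exact connected_of_planeForest_eq h
      · intro hG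
        obtain ⟨T, hT, h⟩ := exists_planeForest_eq hG
        have ha := PlaneTree.block_mem_park hT
        refine ⟨T.block n, ha, ?_⟩
        rw [h, PlaneTree.eq_of_block_eq (hτ1 _ ha) hT (hτ2 _ ha)]
    · intro a ha b hb hab
      rw [Function.onFun, Finset.disjoint_left]
      intro G h2 h3
      have h4 := (Finset.mem_filter.1 h2).2.symm.trans (Finset.mem_filter.1 h3).2
      rw [List.cons.injEq] at h4
      exact hab (by rw [← hτ2 a ha, ← hτ2 b hb, h4.1])
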